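/- Let $\varepsilon>0$, let $m_0\in\mathbb R^2$, and let $l_i(0)\in\mathbb R^2\setminus\{m_0\}$ for $i=1,2,\dots$ be points. A lion path of lion $i$ is a $1$-Lipschitz map $l_i:[0,\infty)\to\mathbb R^2$ with the given value $l_i(0)$ at time $0$; a man path is a $(1+\varepsilon)$-Lipschitz map $m:[0,\infty)\to\mathbb R^2$ with $m(0)=m_0$. A strategy against $n$ lions is a map $M$ that assigns a man path to every tuple $(l_1,\dots,l_n)$ of lion paths, such that if two tuples agree on $[0,t)$, then the assigned man paths agree on $[0,t]$. It is equitemporal with step $\sigma>0$ if, for every integer $i\ge 0$, the man paths assigned to two tuples that agree on $[0,i\sigma]$ agree on $[0,(i+1)\sigma]$. Put $\varepsilon_n=(1-2^{-n})\varepsilon$. To every sequence $\delta=(\delta_i)_{i\ge 2}$ of positive reals and every $n\ge 1$ one can assign a strategy $M_n$ against the lions $1,\dots,n$, reals $c_n>0$ and $\sigma_n>0$ and, for $n\ge 2$, a real $r_n>0$ and an integer $p_n\ge 1$, such that the following holds for all lion paths $l_1,l_2,\dots$, where $M_n(t)$ denotes the position at time $t$ on the man path that $M_n$ assigns to $(l_1,\dots,l_n)$.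 1. $\|M_n(t)-l_n(t)\|\ge c_n$ for all $t\ge 0$. 2. If $n\ge 2$, then $\|M_{n-1}(t)-M_n(t)\|\le\delta_n$ for all $t\ge 0$. 3. $M_n$, $c_n$, $\sigma_n$, $r_n$, $p_n$ depend only on $\delta_2,\dots,\delta_n$ (for fixed $\varepsilon$, $m_0$ and $l_i(0)$). 4. $M_n$ is equitemporal with step $\sigma_n$. With $t_i=i\sigma_n$, the path $M_n$ is a polygonal chain with corners $M_n(t_0),M_n(t_1),\dots$, all of whose segments have length $\sigma_n(1+\varepsilon_n)$ and are traversed at constant speed $1+\varepsilon_n$. 5. Let $n\ge 2$, put $h=\sigma_{n-1}/p_n$, $d=\sigma_n(1+\varepsilon_n)$ and $r=r_n$. Then $h(1+\varepsilon_{n-1})\le\delta_n/2$. For every $i\ge 0$ let $x=M_n(t_i)$, $y=l_n(t_i)$, let $g=M_{n-1}\big((\lfloor t_i/h\rfloor+1)h\big)$ be the goal and, if $x\ne g$, let $b$ be the point at distance $d$ from $x$ in the direction toward $g$. Then $M_n(t_{i+1})$ is given by one of the following moves. - Free move: if $\|x-y\|\ge r+d$, then $M_n(t_{i+1})=b$ if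 $x\neq g$, and $M_n(t_{i+1})$ is some point at distance $d$ from $x$ if $x=g$. - Escape move: if $\|x-y\|<r+d$, $x\ne g$, and there are parallel lines $W_0\ni x$ and $W_1\ni b$ with $\operatorname{dist}(y,W_0)\ge r-\sigma_n$ and $\operatorname{dist}(y,W_1)\ge\operatorname{dist}(y,W_0)+\sigma_n$, then $M_n(t_{i+1})=b$. - Avoidance move: in all remaining cases, the circle of radius $d$ about $x$ and the circle of radius $r$ about $y$ intersect in two points, and $M_n(t_{i+1})$ is that intersection point $q$ for which the open arc of the circle about $y$ that leads counterclockwise from the other intersection point to $q$ lies inside the circle about $x$. -/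

import Mathlib

open scoped NNReal

/-- The Euclidean plane. -/
abbrev Plane : Type := EuclideanSpace ℝ (Fin 2)

/-- A path `[0, ∞) → ℝ²` that starts at `x₀` and has speed at most `v`. -/
structure PathFrom (v : ℝ) (x₀ : Plane) where
  toFun : ℝ≥0 → Plane
  start : toFun 0 = x₀
  speed : ∀ s t : ℝ≥0, ‖toFun s - toFun t‖ ≤ v * |(s : ℝ) - (t : ℝ)|

instance (v : ℝ) (x₀ : Plane) : CoeFun (PathFrom v x₀) (fun _ => ℝ≥0 → Plane) :=
  ⟨PathFrom.toFun⟩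

/-- Lions run with at most unit speed. -/
abbrev LionPath (x₀ : Plane) : Type := PathFrom 1 x₀

/-- The man runs with speed at most `1 + ε`. -/
abbrev ManPath (ε : ℝ) (x₀ : Plane) : Type := PathFrom (1 + ε) x₀

/-- A strategy for a man starting at `m₀` against lions starting at the points `l₀ i`:
a map from families of lion paths to man paths such that the man's path up to time `t`
depends only on the lions' paths before time `t`. -/
structure ManStrategy (ε : ℝ) (m₀ : Plane) {ι : Type} (l₀ : ι → Plane) where
  toFun : (∀ i, LionPath (l₀ i)) → ManPath ε m₀
  causal : ∀ (l l' : ∀ i, LionPath (l₀ i)) (t : ℝ≥0),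
    (∀ i, ∀ s < t, l i s = l' i s) → ∀ s ≤ t, toFun l s = toFun l' s

/-- A strategy against the lions `1, …, n`. -/
abbrev StrategyAgainst (ε : ℝ) (m₀ : Plane) (l₀ : ℕ → Plane) (n : ℕ) : Type :=
  ManStrategy ε m₀ (fun i : Set.Icc 1 n => l₀ i)

/-- The man path that a strategy against the lions `1, …, n` prescribes when
the lions run along `l 1, l 2, …`. -/
def ManStrategy.run {ε : ℝ} {m₀ : Plane} {l₀ : ℕ → Plane} {n : ℕ}
    (M : StrategyAgainst ε m₀ l₀ n) (l : ∀ i, LionPath (l₀ i)) : ManPath ε m₀ :=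
  M.toFun (fun i => l i)

/-- At every time `i * σ` the man decides his behavior until time `(i + 1) * σ`. -/
def ManStrategy.IsEquitemporal {ε : ℝ} {m₀ : Plane} {ι : Type} {l₀ : ι → Plane}
    (M : ManStrategy ε m₀ l₀) (σ : ℝ≥0) : Prop :=
  0 < σ ∧ ∀ (i : ℕ) (l l' : ∀ j, LionPath (l₀ j)),
    (∀ j, ∀ s ≤ i * σ, l j s = l' j s) →
      ∀ s ≤ (i + 1) * σ, M.toFun l s = M.toFun l' s

/-- The path `m` is a polygonal chain with corners at the times `i * σ`, all segments have length
`σ * v`, and each of them is traversed with constant speed `v`. -/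
def IsEqualPolygonal (m : ℝ≥0 → Plane) (σ : ℝ≥0) (v : ℝ) : Prop :=
  ∀ i : ℕ, ‖m ((i + 1) * σ) - m (i * σ)‖ = σ * v ∧
    ∀ s : ℝ≥0, s ≤ 1 →
      m ((i + s) * σ) = AffineMap.lineMap (m (i * σ)) (m ((i + 1) * σ)) (s : ℝ)

/-- `ε_n = (1 - 2⁻ⁿ) ε`. -/
noncomputable def excess (ε : ℝ) (n : ℕ) : ℝ := (1 - 1 / 2 ^ n) * ε

/-- The first multiple of `h` after time `t`. -/
noncomputable def nextMultiple (h t : ℝ≥0) : ℝ≥0 := (⌊t / h⌋₊ + 1) * h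

/-- The point at distance `d` from `x` in the direction toward `g` (for `g ≠ x`). -/
noncomputable def stepToward (d : ℝ) (x g : Plane) : Plane := x + (d / ‖g - x‖) • (g - x)

/-- The point at angle `α` on the circle with center `y` and radius `r`. -/
noncomputable def circlePoint (y : Plane) (r α : ℝ) : Plane :=
  y + r • (!₂[Real.cos α, Real.sin α] : Plane)

/-- A line in the plane. -/
def IsLine (W : AffineSubspace ℝ Plane) : Prop :=
  (W : Set Plane).Nonempty ∧ Module.finrank ℝ W.direction = 1

/-- Parallel lines through the man's position `x` and through `b` that certify that a lion at `y`
cannot disturb him while he runs from `x` to `b`. -/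
def EscapeLines (r σ : ℝ) (x y b : Plane) : Prop :=
  ∃ W₀ W₁ : AffineSubspace ℝ Plane, IsLine W₀ ∧ IsLine W₁ ∧ W₀.Parallel W₁ ∧
    x ∈ W₀ ∧ b ∈ W₁ ∧
    r - σ ≤ Metric.infDist y (W₀ : Set Plane) ∧
    Metric.infDist y (W₀ : Set Plane) + σ ≤ Metric.infDist y (W₁ : Set Plane)

/-- The circles with centers `x`, `y` and radii `d`, `r` meet in two points, `q` is one of them, and
the arc of the circle around `y` that leads counterclockwise from the other one to `q` lies in the
interior of the circle around `x`. -/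
def IsAvoidancePoint (r d : ℝ) (x y q : Plane) : Prop :=
  ∃ α β : ℝ, α < β ∧ β < α + 2 * Real.pi ∧ q = circlePoint y r β ∧
    ‖circlePoint y r α - x‖ = d ∧ ‖circlePoint y r β - x‖ = d ∧
    ∀ γ, α < γ → γ < β → ‖circlePoint y r γ - x‖ < d

/-- The man, at `x`, with goal `g` and a lion at `y`, runs for time `σ` at speed `v` to the
point `z` in a free move (in an arbitrary direction if `x = g`). -/
def IsFreeMove (r σ v : ℝ) (x y g z : Plane) : Prop :=
  r + σ * v ≤ ‖x - y‖ ∧ ‖z - x‖ = σ * v ∧ (x ≠ g → z = stepToward (σ * v) x g)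

/-- The man runs to `z` in an escape move. -/
def IsEscapeMove (r σ v : ℝ) (x y g z : Plane) : Prop :=
  ‖x - y‖ < r + σ * v ∧ x ≠ g ∧ EscapeLines r σ x y (stepToward (σ * v) x g) ∧
    z = stepToward (σ * v) x g

/-- The man runs to `z` in an avoidance move. -/
def IsAvoidanceMove (r σ v : ℝ) (x y g z : Plane) : Prop :=
  ‖x - y‖ < r + σ * v ∧ ¬ (x ≠ g ∧ EscapeLines r σ x y (stepToward (σ * v) x g)) ∧
    IsAvoidancePoint r (σ * v) x y z

/-- In every time interval `[i * σ, (i + 1) * σ]`, the man path `m` makes a free, an escape or an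
avoidance move with respect to the lion path `l`, and the goal is the position on the path
`m'` at the first multiple of `h` after time `i * σ`. -/
def FollowsByMoves (r : ℝ) (σ : ℝ≥0) (v : ℝ) (h : ℝ≥0) (m' l m : ℝ≥0 → Plane) : Prop :=
  ∀ i : ℕ,
    IsFreeMove r σ v (m (i * σ)) (l (i * σ)) (m' (nextMultiple h (i * σ))) (m ((i + 1) * σ)) ∨
    IsEscapeMove r σ v (m (i * σ)) (l (i * σ)) (m' (nextMultiple h (i * σ))) (m ((i + 1) * σ)) ∨
    IsAvoidanceMove r σ v (m (i * σ)) (l (i * σ)) (m' (nextMultiple h (i * σ))) (m ((i + 1) * σ))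

/-! The strategies are built recursively, one lion at a time. Let v' < v be the old and the new
speed and d = σv. The man pursues points slightly ahead on the old path, and the surplus v − v' pays
for his detours around the new lion.

Safety: at decision times the man is at distance at least r − σ from the new lion, and each kind of
move preserves this (`MoveParams.le_norm_move_sub`).

Closeness: during consecutive avoidance moves the direction from lion to man turns counterclockwise,
by at least (d − σ)/r per move and never by a large angle (`IsCcwPoint.exists_angle`). Before a full
turn is complete it nearly points to the goal, if the goal is far away; then it is the normal of
escape lines (`MoveParams.escapeNormal_of_cos`). Hence at most N avoidance moves occur in a row
(`MoveParams.not_forall_isCcwMove`). An escape normal stays valid while the goal is fixed and far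
(`MoveParams.escapeNormal_move`), so in such a phase at most N moves are wasted. Since N d is at
most a multiple of r that does not depend on σ (`exists_moveParams`), a small r makes the loss 2Nd
smaller than the gain h(v − v') per goal, and errors do not accumulate
(`MoveParams.norm_sub_goal_seq_le`).

Causality: h divides the old step, so the next goal lies on a part of the old path that is already
decided. -/

open Real InnerProductSpace

/-! ### Unit vectors and polar coordinates. -/

/-- The unit vector at angle `α`. -/
noncomputable def unitVec (α : ℝ) : Plane := !₂[Real.cos α, Real.sin α]

theorem circlePoint_eq (y : Plane) (r α : ℝ) : circlePoint y r α = y + r • unitVec α := rfl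

theorem inner_unitVec (α β : ℝ) : ⟪unitVec α, unitVec β⟫_ℝ = cos (α - β) := by
  simp [unitVec, PiLp.inner_apply, Fin.sum_univ_two, cos_sub]
  ring

theorem norm_unitVec (α : ℝ) : ‖unitVec α‖ = 1 := by
  have h : ‖unitVec α‖ ^ 2 = 1 := by
    rw [← real_inner_self_eq_norm_sq, inner_unitVec]; simp
  exact (pow_eq_one_iff_of_nonneg (norm_nonneg _) two_ne_zero).1 h

theorem norm_unitVec_sub_sq (α β : ℝ) :
    ‖unitVec α - unitVec β‖ ^ 2 = 2 - 2 * cos (α - β) := by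
  rw [norm_sub_sq_real, norm_unitVec, norm_unitVec, inner_unitVec]; ring

theorem unitVec_add_int_mul (α : ℝ) (k : ℤ) : unitVec (α + k * (2 * π)) = unitVec α := by
  simp [unitVec, cos_add_int_mul_two_pi, sin_add_int_mul_two_pi]

theorem exists_polar (z : Plane) : ∃ θ, z = ‖z‖ • unitVec θ := by
  let w : ℂ := ⟨z 0, z 1⟩
  have hw : ‖w‖ = ‖z‖ := by
    rw [EuclideanSpace.norm_eq, Fin.sum_univ_two, Complex.norm_def, Complex.normSq_apply]
    simp [w, sq]
  refine ⟨Complex.arg w, ?_⟩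
  ext i
  fin_cases i
  · simpa [unitVec, hw] using (Complex.norm_mul_cos_arg w).symm
  · simpa [unitVec, hw] using (Complex.norm_mul_sin_arg w).symm

/-! ### Lines, their normals, and escape certificates. -/

theorem exists_unit_normal {V : Submodule ℝ Plane} (hV : Module.finrank ℝ V = 1) :
    ∃ ν : Plane, ‖ν‖ = 1 ∧ V = (ℝ ∙ ν)ᗮ := by
  have h2 : Module.finrank ℝ Plane = 2 := by simp
  have h1 : Module.finrank ℝ Vᗮ = 1 := by
    have := Submodule.finrank_add_finrank_orthogonal V
    omega
  obtain ⟨w, hw, hw0⟩ := Submodule.exists_mem_ne_zero_of_ne_bot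
    (p := Vᗮ) (by rintro h; rw [h] at h1; simp at h1)
  have hn : ‖(‖w‖⁻¹ : ℝ) • w‖ = 1 := by
    rw [norm_smul, norm_inv, norm_norm, inv_mul_cancel₀ (norm_ne_zero_iff.2 hw0)]
  refine ⟨(‖w‖⁻¹ : ℝ) • w, hn, ?_⟩
  have hle : (ℝ ∙ ((‖w‖⁻¹ : ℝ) • w)) ≤ Vᗮ := by
    rw [Submodule.span_singleton_le_iff_mem]; exact Submodule.smul_mem _ _ hw
  have heq := Submodule.eq_of_le_of_finrank_eq hle
    (by rw [h1, finrank_span_singleton (by rintro h; rw [h] at hn; simp at hn)])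
  rw [heq, Submodule.orthogonal_orthogonal]

theorem finrank_orthogonal_unit {ν : Plane} (hν : ‖ν‖ = 1) :
    Module.finrank ℝ ((ℝ ∙ ν)ᗮ : Submodule ℝ Plane) = 1 := by
  have h2 : Module.finrank ℝ Plane = 2 := by simp
  have h1 : Module.finrank ℝ (ℝ ∙ ν) = 1 :=
    finrank_span_singleton (by rintro h; rw [h] at hν; simp at hν)
  have := Submodule.finrank_add_finrank_orthogonal (ℝ ∙ ν)
  omega

theorem infDist_of_direction_eq {W : AffineSubspace ℝ Plane} {ν p : Plane} (hν : ‖ν‖ = 1)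
    (hW : W.direction = (ℝ ∙ ν)ᗮ) (hp : p ∈ W) (y : Plane) :
    Metric.infDist y (W : Set Plane) = |⟪p - y, ν⟫_ℝ| := by
  have hmem : ∀ z, z ∈ W ↔ ⟪z - p, ν⟫_ℝ = 0 := fun z => by
    rw [← AffineSubspace.vsub_right_mem_direction_iff_mem hp, hW,
      Submodule.mem_orthogonal_singleton_iff_inner_left]
    rfl
  apply le_antisymm
  · have hz : y + ⟪p - y, ν⟫_ℝ • ν ∈ W := by
      rw [hmem]
      have h : y + ⟪p - y, ν⟫_ℝ • ν - p = ⟪p - y, ν⟫_ℝ • ν - (p - y) := by abel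
      rw [h, inner_sub_left, real_inner_smul_left, real_inner_self_eq_norm_sq, hν]; ring
    refine (Metric.infDist_le_dist_of_mem hz).trans ?_
    rw [dist_eq_norm, sub_add_cancel_left, norm_neg, norm_smul, hν, mul_one, Real.norm_eq_abs]
  · refine (Metric.le_infDist ⟨p, hp⟩).2 fun z hz => ?_
    have h : ⟪p - y, ν⟫_ℝ = ⟪z - y, ν⟫_ℝ := by
      have := (hmem z).1 hz
      rw [inner_sub_left] at *
      rw [inner_sub_left]; linarith
    rw [h, dist_comm, dist_eq_norm]
    simpa [hν] using abs_real_inner_le_norm (z - y) ν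

/-- The lion at `y` stays behind the line through `x` with normal `ν`, and the step from `x` to `b`
moves this line away from the lion by at least `σ`. -/
def EscapeNormal (r σ : ℝ) (x y b ν : Plane) : Prop :=
  ‖ν‖ = 1 ∧ r - σ ≤ ⟪x - y, ν⟫_ℝ ∧ σ ≤ ⟪b - x, ν⟫_ℝ

theorem EscapeNormal.escapeLines {r σ : ℝ} {x y b ν : Plane} (hσ : 0 ≤ σ) (hr : σ ≤ r)
    (h : EscapeNormal r σ x y b ν) : EscapeLines r σ x y b := by
  obtain ⟨hν, h1, h2⟩ := h
  have hx := infDist_of_direction_eq (W := AffineSubspace.mk' x (ℝ ∙ ν)ᗮ) hν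
    (AffineSubspace.direction_mk' _ _) (AffineSubspace.self_mem_mk' _ _) y
  have hb := infDist_of_direction_eq (W := AffineSubspace.mk' b (ℝ ∙ ν)ᗮ) hν
    (AffineSubspace.direction_mk' _ _) (AffineSubspace.self_mem_mk' _ _) y
  have hsum : ⟪b - y, ν⟫_ℝ = ⟪b - x, ν⟫_ℝ + ⟪x - y, ν⟫_ℝ := by
    rw [← inner_add_left, sub_add_sub_cancel]
  rw [abs_of_nonneg (by linarith)] at hx hb
  refine ⟨_, _, ⟨⟨x, AffineSubspace.self_mem_mk' x (ℝ ∙ ν)ᗮ⟩, ?_⟩,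
    ⟨⟨b, AffineSubspace.self_mem_mk' b (ℝ ∙ ν)ᗮ⟩, ?_⟩, ?_, AffineSubspace.self_mem_mk' _ _,
    AffineSubspace.self_mem_mk' _ _, ?_, ?_⟩
  · rw [AffineSubspace.direction_mk']; exact finrank_orthogonal_unit hν
  · rw [AffineSubspace.direction_mk']; exact finrank_orthogonal_unit hν
  · rw [AffineSubspace.parallel_iff_direction_eq_and_eq_bot_iff_eq_bot]
    refine ⟨by simp only [AffineSubspace.direction_mk'], iff_of_false ?_ ?_⟩ <;>
    exact (AffineSubspace.nonempty_iff_ne_bot _).1 (AffineSubspace.mk'_nonempty _ _)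
  · rw [hx]; exact h1
  · rw [hx, hb]; linarith

/-- Orient the normal so that `x` is on its nonnegative side as seen from `y`. The line through `b`
could also be farther from `y` by lying on the other side of it, but then the step would have length
at least 2r − σ. -/
theorem EscapeLines.exists_escapeNormal {r σ : ℝ} {x y b : Plane}
    (hb : ‖b - x‖ < 2 * r - σ) (h : EscapeLines r σ x y b) : ∃ ν, EscapeNormal r σ x y b ν := by
  obtain ⟨W₀, W₁, ⟨-, hW₀⟩, -, hpar, hx, hb₁, h1, h2⟩ := h
  obtain ⟨ν, hν, hdir⟩ := exists_unit_normal hW₀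
  rw [infDist_of_direction_eq hν hdir hx] at h1 h2
  rw [infDist_of_direction_eq hν (hpar.direction_eq ▸ hdir) hb₁] at h2
  have hsum : ⟪b - y, ν⟫_ℝ = ⟪b - x, ν⟫_ℝ + ⟪x - y, ν⟫_ℝ := by
    rw [← inner_add_left, sub_add_sub_cancel]
  have hcs := abs_real_inner_le_norm (b - x) ν
  rw [hν, mul_one] at hcs
  obtain ⟨hc1, hc2⟩ := abs_le.1 hcs
  rw [hsum] at h2
  rcases le_total 0 ⟪x - y, ν⟫_ℝ with hs | hs
  · rw [abs_of_nonneg hs] at h1 h2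
    refine ⟨ν, hν, h1, ?_⟩
    rcases le_abs'.1 h2 with h | h <;> linarith
  · rw [abs_of_nonpos hs] at h1 h2
    refine ⟨-ν, by rwa [norm_neg], by rwa [inner_neg_right], ?_⟩
    rw [inner_neg_right]
    rcases le_abs'.1 h2 with h | h <;> linarith

/-! ### Intersecting circles and counterclockwise turning. -/

/-- A point of the circle around `y` at angle `θ + a`, where the part of this circle inside the
circle around `x` consists of the angles within `a` of `θ`. -/
def IsCcwPoint (r d : ℝ) (x y q : Plane) : Prop :=
  ∃ θ a c : ℝ, 0 < c ∧ 0 < a ∧ a < π / 2 ∧ q = circlePoint y r (θ + a) ∧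
    ∀ γ, ‖circlePoint y r γ - x‖ ^ 2 = d ^ 2 + c * (cos a - cos (γ - θ))

/-- Law of cosines with θ the direction of x − y: the squared distance is D² + r² − 2Dr cos(γ − θ),
so cos a = κ and c = 2Dr. The condition d < r gives κ > 0, that is, a < π/2. -/
theorem exists_isCcwPoint {r d : ℝ} {x y : Plane} (hd : 0 < d) (hdr : d < r)
    (h1 : r - d < ‖x - y‖) (h2 : ‖x - y‖ < r + d) : ∃ q, IsCcwPoint r d x y q := by
  obtain ⟨θ, hθ⟩ := exists_polar (x - y)
  set D := ‖x - y‖ with hD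
  have hD0 : 0 < D := by linarith
  have hr0 : 0 < r := by linarith
  have hc : 0 < 2 * D * r := by positivity
  set κ := (D ^ 2 + r ^ 2 - d ^ 2) / (2 * D * r) with hκ
  have hκ0 : 0 < κ := div_pos (by nlinarith) hc
  have hκ1 : κ < 1 := by rw [hκ, div_lt_one hc]; nlinarith
  refine ⟨_, θ, arccos κ, 2 * D * r, hc, arccos_pos.2 hκ1, arccos_lt_pi_div_two.2 hκ0, rfl, ?_⟩
  intro γ
  rw [cos_arccos (by linarith) hκ1.le]
  have : circlePoint y r γ - x = r • unitVec γ - D • unitVec θ := by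
    rw [← hθ, circlePoint_eq]; abel
  rw [this, norm_sub_sq_real, norm_smul, norm_smul, norm_unitVec, norm_unitVec,
    real_inner_smul_left, real_inner_smul_right, inner_unitVec, Real.norm_eq_abs,
    Real.norm_eq_abs, mul_one, mul_one, sq_abs, sq_abs, hκ]
  field_simp
  ring

theorem IsCcwPoint.norm_sub {r d : ℝ} {x y q : Plane} (hd : 0 ≤ d) (h : IsCcwPoint r d x y q) :
    ‖q - x‖ = d := by
  obtain ⟨θ, a, c, hc, ha0, ha1, rfl, h⟩ := h
  have := h (θ + a)
  rw [add_sub_cancel_left, sub_self, mul_zero, add_zero] at this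
  exact (sq_eq_sq₀ (norm_nonneg _) hd).1 this

theorem IsCcwPoint.isAvoidancePoint {r d : ℝ} {x y q : Plane} (hd : 0 ≤ d)
    (hq : IsCcwPoint r d x y q) : IsAvoidancePoint r d x y q := by
  have hqd := hq.norm_sub hd
  obtain ⟨θ, a, c, hc, ha0, ha1, rfl, h⟩ := hq
  refine ⟨θ - a, θ + a, by linarith, by linarith [pi_pos], rfl, ?_, hqd, ?_⟩
  · have := h (θ - a)
    rw [sub_sub_cancel_left, cos_neg, sub_self, mul_zero, add_zero] at this
    exact (sq_eq_sq₀ (norm_nonneg _) hd).1 this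
  · intro γ h1 h2
    refine lt_of_pow_lt_pow_left₀ 2 hd ?_
    rw [h γ]
    have : cos a < cos (γ - θ) := by
      rw [← cos_abs (γ - θ)]
      exact cos_lt_cos_of_nonneg_of_le_pi (abs_nonneg _) (by linarith [pi_pos])
        (abs_lt.2 ⟨by linarith, by linarith⟩)
    nlinarith

/-- Between two consecutive avoidance moves, the direction from the lion to the man turns
counterclockwise. -/
theorem IsCcwPoint.exists_angle {r d σ B : ℝ} {x y y' q : Plane} (hr : 0 < r) (hσ : 0 ≤ σ)
    (hd : σ < d) (hx : x = circlePoint y r B) (hy : ‖y' - y‖ ≤ σ)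
    (hq : IsCcwPoint r d x y' q) :
    ∃ B', q = circlePoint y' r B' ∧ B + (d - σ) / r ≤ B' ∧ B' ≤ B + π * (d + σ) / (2 * r) := by
  have hqd := hq.norm_sub (by linarith)
  obtain ⟨θ, a, c, hc, ha0, ha1, rfl, h⟩ := hq
  -- Carried along with the lion, the point at angle B is within σ < d of `x`, so it lies on the arc
  -- inside the circle about `x`. With φ the representative of B − θ in (−π, π], this means |φ| < a,
  -- and the turn is t = a − φ.
  have hin : cos a < cos (B - θ) := by
    have h1 := h B
    have h2 : circlePoint y' r B - x = y' - y := by rw [hx, circlePoint_eq, circlePoint_eq]; abel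
    rw [h2] at h1
    have h3 : ‖y' - y‖ ^ 2 < d ^ 2 := by gcongr; linarith
    nlinarith
  set φ := toIocMod two_pi_pos (-π) (B - θ) with hφ
  obtain ⟨hφ1, hφ2⟩ := toIocMod_mem_Ioc two_pi_pos (-π) (B - θ)
  rw [← hφ] at hφ1 hφ2
  set k := toIocDiv two_pi_pos (-π) (B - θ)
  have hBk : B - θ = φ + k * (2 * π) := by
    have := toIocMod_add_toIocDiv_zsmul two_pi_pos (-π) (B - θ)
    rw [zsmul_eq_mul] at this
    exact this.symm
  rw [hBk, cos_add_int_mul_two_pi] at hin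
  have hφa : |φ| < a := by
    by_contra! hcon
    rw [← cos_abs φ] at hin
    exact absurd (cos_le_cos_of_nonneg_of_le_pi ha0.le (abs_le.2 ⟨by linarith, by linarith⟩) hcon)
      (not_le.2 hin)
  obtain ⟨hφ3, hφ4⟩ := abs_lt.1 hφa
  have hB' : unitVec (θ + a + k * (2 * π)) = unitVec (θ + a) := unitVec_add_int_mul _ _
  have hdiff : θ + a + k * (2 * π) - B = a - φ := by linarith
  set t := a - φ with ht
  have ht0 : 0 < t := by linarith
  have htπ : t < π := by linarith
  have hchord : ‖unitVec (θ + a + k * (2 * π)) - unitVec B‖ ^ 2 = 2 - 2 * cos t := by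
    rw [norm_unitVec_sub_sq, hdiff]
  have hvec : circlePoint y' r (θ + a) - x =
      r • (unitVec (θ + a + k * (2 * π)) - unitVec B) + (y' - y) := by
    rw [hB', hx, circlePoint_eq, circlePoint_eq, smul_sub]; abel
  set w := unitVec (θ + a + k * (2 * π)) - unitVec B with hw
  have hrw : ‖r • w‖ = r * ‖w‖ := by rw [norm_smul, Real.norm_eq_abs, abs_of_pos hr]
  -- The chord r‖w‖ differs from d by at most the lion's step, and a turn by t ∈ (0, π) has 2t/π ≤
  -- ‖w‖ ≤ t.
  have hlow : d - σ ≤ r * ‖w‖ := by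
    have := norm_add_le (r • w) (y' - y)
    rw [← hvec, hqd, hrw] at this
    linarith
  have hupp : r * ‖w‖ ≤ d + σ := by
    have := norm_sub_le (circlePoint y' r (θ + a) - x) (y' - y)
    rw [hqd, hvec, add_sub_cancel_right, hrw] at this
    linarith
  have hwt : ‖w‖ ≤ t := by
    refine le_of_sq_le_sq ?_ ht0.le
    rw [hchord]
    linarith [one_sub_sq_div_two_le_cos (x := t)]
  have htw : 2 / π * t ≤ ‖w‖ := by
    refine le_of_sq_le_sq ?_ (norm_nonneg _)
    rw [hchord]
    have h4 := cos_le_one_sub_mul_cos_sq (x := t) (by rw [abs_of_pos ht0]; exact htπ.le)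
    have h5 : (2 / π * t) ^ 2 = 2 * (2 / π ^ 2 * t ^ 2) := by ring
    rw [h5]; linarith
  refine ⟨θ + a + k * (2 * π), by rw [circlePoint_eq, circlePoint_eq, hB'], ?_, ?_⟩
  · have : (d - σ) / r ≤ t := by
      rw [div_le_iff₀ hr]; nlinarith
    linarith
  · have : t ≤ π * (d + σ) / (2 * r) := by
      rw [le_div_iff₀ (by linarith)]
      have h6 : t ≤ π / 2 * ‖w‖ := by
        have := mul_le_mul_of_nonneg_left htw (div_nonneg pi_pos.le zero_le_two)
        rwa [← mul_assoc, div_mul_div_comm, mul_comm π 2, div_self (by positivity), one_mul] at this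
      have h7 := mul_le_mul_of_nonneg_left hupp pi_pos.le
      nlinarith
    linarith

/-! ### Steps toward a goal, and the three kinds of moves. -/

theorem norm_stepToward_sub {d : ℝ} {x g : Plane} (hd : 0 ≤ d) (hxg : x ≠ g) :
    ‖stepToward d x g - x‖ = d := by
  have h : ‖g - x‖ ≠ 0 := norm_ne_zero_iff.2 (sub_ne_zero.2 hxg.symm)
  rw [stepToward, add_sub_cancel_left, norm_smul, norm_div, norm_norm, Real.norm_eq_abs,
    abs_of_nonneg hd, div_mul_cancel₀ _ h]

theorem sub_stepToward (d : ℝ) (x g : Plane) :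
    g - stepToward d x g = (1 - d / ‖g - x‖) • (g - x) := by
  rw [stepToward, sub_smul, one_smul]; abel

theorem norm_sub_stepToward {d : ℝ} {x g : Plane} (hd : 0 ≤ d) (hxg : d < ‖g - x‖) :
    ‖g - stepToward d x g‖ = ‖g - x‖ - d := by
  have h : 0 < ‖g - x‖ := by linarith
  have h1 : d / ‖g - x‖ < 1 := (div_lt_one h).2 hxg
  rw [sub_stepToward, norm_smul, Real.norm_eq_abs, abs_of_pos (by linarith)]
  field_simp

theorem stepToward_stepToward_sub {d : ℝ} {x g : Plane} (hd : 0 ≤ d) (hxg : d < ‖g - x‖) :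
    stepToward d (stepToward d x g) g - stepToward d x g = stepToward d x g - x := by
  have h : 0 < ‖g - x‖ := by linarith
  have h1 : ‖g - x‖ - d ≠ 0 := by linarith
  rw [stepToward.eq_1 d (stepToward d x g) g, norm_sub_stepToward hd hxg, sub_stepToward,
    add_sub_cancel_left, smul_smul, stepToward, add_sub_cancel_left]
  congr 1
  field_simp

/-- The man evades the lion counterclockwise. -/
def IsCcwMove (r σ v : ℝ) (x y g z : Plane) : Prop :=
  ‖x - y‖ < r + σ * v ∧ ¬ (x ≠ g ∧ EscapeLines r σ x y (stepToward (σ * v) x g)) ∧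
    IsCcwPoint r (σ * v) x y z

/-- A free move, an escape move, or a counterclockwise avoidance move. -/
def IsMove (r σ v : ℝ) (x y g z : Plane) : Prop :=
  IsFreeMove r σ v x y g z ∨ IsEscapeMove r σ v x y g z ∨ IsCcwMove r σ v x y g z

/-- The relations between the radius `r`, the step `σ`, the speed `v`, a bound `N` on the number of
consecutive avoidance moves, and a distance `R` beyond which the goal counts as far away. -/
structure MoveParams (r σ v : ℝ) (N : ℕ) (R : ℝ) : Prop where
  step_pos : 0 < σ
  one_lt : 1 < v
  four_mul_le : 4 * (σ * v) ≤ r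
  turn : 2 * π * r ≤ ((N : ℝ) - 1) * ((v - 1) * σ)
  drift : ((N : ℝ) + 1) * (σ * v) ≤ (1 - 1 / v) / 4 * R
  angle : (π * (σ * v + σ) / (2 * r)) ^ 2 ≤ 1 - 1 / v

namespace MoveParams

variable {r σ v R : ℝ} {N : ℕ}

theorem len_pos (P : MoveParams r σ v N R) : 0 < σ * v :=
  mul_pos P.step_pos (by linarith [P.one_lt])

theorem step_lt (P : MoveParams r σ v N R) : σ < σ * v := by
  nlinarith [P.step_pos, P.one_lt]

theorem r_pos (P : MoveParams r σ v N R) : 0 < r := by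
  linarith [P.four_mul_le, P.len_pos]

theorem frac_pos (P : MoveParams r σ v N R) : 0 < 1 - 1 / v := by
  have := (div_lt_one (by linarith [P.one_lt] : 0 < v)).2 P.one_lt
  linarith

theorem len_lt (P : MoveParams r σ v N R) : σ * v < R := by
  have h1 := P.drift
  have h2 := P.frac_pos
  have h3 := P.len_pos
  have h4 : 0 < 1 / v := one_div_pos.2 (by linarith [P.one_lt])
  have h5 : (0 : ℝ) ≤ N := N.cast_nonneg
  have h6 : 0 < R := by
    by_contra! h
    nlinarith
  nlinarith

theorem isAvoidanceMove_of_isCcwMove (P : MoveParams r σ v N R) {x y g z : Plane}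
    (h : IsCcwMove r σ v x y g z) : IsAvoidanceMove r σ v x y g z :=
  ⟨h.1, h.2.1, h.2.2.isAvoidancePoint P.len_pos.le⟩

theorem exists_escapeNormal (P : MoveParams r σ v N R) {x y g : Plane} (hxg : x ≠ g)
    (h : EscapeLines r σ x y (stepToward (σ * v) x g)) :
    ∃ ν, EscapeNormal r σ x y (stepToward (σ * v) x g) ν := by
  refine h.exists_escapeNormal ?_
  rw [norm_stepToward_sub P.len_pos.le hxg]
  linarith [P.len_pos, P.step_lt, P.four_mul_le]

theorem escapeLines (P : MoveParams r σ v N R) {x y b ν : Plane} (h : EscapeNormal r σ x y b ν) :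
    EscapeLines r σ x y b :=
  h.escapeLines P.step_pos.le (by linarith [P.len_pos, P.step_lt, P.four_mul_le])

theorem norm_move_sub (P : MoveParams r σ v N R) {x y g z : Plane} (h : IsMove r σ v x y g z) :
    ‖z - x‖ = σ * v := by
  rcases h with h | h | h
  · exact h.2.1
  · rw [h.2.2.2]; exact norm_stepToward_sub P.len_pos.le h.2.1
  · exact h.2.2.norm_sub P.len_pos.le

theorem inner_sub_le_of_norm_sub_le {σ : ℝ} {y y' ν : Plane} (hν : ‖ν‖ = 1)
    (hy : ‖y' - y‖ ≤ σ) : ⟪y' - y, ν⟫_ℝ ≤ σ := by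
  have := real_inner_le_norm (y' - y) ν
  rw [hν, mul_one] at this
  exact this.trans hy

/-- A free move starts at distance at least r + d, and man and lion together use up at most d + σ.
In an escape move the component along the normal grows by at least σ and the lion regains at most σ.
An avoidance move ends at distance r from the lion's old position. -/
theorem le_norm_move_sub (P : MoveParams r σ v N R) {x y y' g z : Plane}
    (h : IsMove r σ v x y g z) (hy : ‖y' - y‖ ≤ σ) : r - σ ≤ ‖z - y'‖ := by
  have hz := P.norm_move_sub h
  have htri : ‖x - y‖ ≤ ‖z - y'‖ + ‖z - x‖ + ‖y' - y‖ := by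
    have h1 : x - y = (z - y') - (z - x) + (y' - y) := by abel
    calc ‖x - y‖ = ‖(z - y') - (z - x) + (y' - y)‖ := by rw [← h1]
      _ ≤ ‖(z - y') - (z - x)‖ + ‖y' - y‖ := norm_add_le _ _
      _ ≤ _ := by gcongr; exact norm_sub_le _ _
  rcases h with h | h | h
  · linarith [h.1]
  · obtain ⟨-, hxg, hE, rfl⟩ := h
    obtain ⟨ν, hν, h1, h2⟩ := P.exists_escapeNormal hxg hE
    have h3 := inner_sub_le_of_norm_sub_le hν hy
    have h4 := real_inner_le_norm (stepToward (σ * v) x g - y') ν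
    have h5 : stepToward (σ * v) x g - y' =
      (stepToward (σ * v) x g - x) + (x - y) - (y' - y) := by abel
    rw [hν, mul_one] at h4
    refine le_trans ?_ h4
    rw [h5, inner_sub_left, inner_add_left]
    linarith
  · obtain ⟨-, -, θ, a, c, -, -, -, rfl, -⟩ := h
    have h1 : ‖circlePoint y r (θ + a) - y‖ = r := by
      rw [circlePoint_eq, add_sub_cancel_left, norm_smul, norm_unitVec, mul_one,
        Real.norm_eq_abs, abs_of_pos P.r_pos]
    have h2 := norm_sub_le_norm_sub_add_norm_sub (circlePoint y r (θ + a)) y' y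
    linarith

/-- After an avoidance move the lion is within r + σ < r + d. A block of avoidance moves can
therefore end only with an escape move. -/
theorem not_isFreeMove_of_isCcwMove (P : MoveParams r σ v N R) {x y y' g g' z z' : Plane}
    (h : IsCcwMove r σ v x y g z) (hy : ‖y' - y‖ ≤ σ) : ¬ IsFreeMove r σ v z y' g' z' := by
  rintro ⟨h1, -⟩
  obtain ⟨-, -, θ, a, c, -, -, -, rfl, -⟩ := h
  have h2 : ‖circlePoint y r (θ + a) - y‖ = r := by
    rw [circlePoint_eq, add_sub_cancel_left, norm_smul, norm_unitVec, mul_one,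
      Real.norm_eq_abs, abs_of_pos P.r_pos]
  have h3 := norm_sub_le_norm_sub_add_norm_sub (circlePoint y r (θ + a)) y y'
  rw [norm_sub_rev y y'] at h3
  linarith [P.step_lt]

/-- The safety bound r − σ > r − d is what makes the two circles intersect when neither a free nor
an escape move applies. -/
theorem exists_move (P : MoveParams r σ v N R) {x y : Plane} (g : Plane) (h : r - σ ≤ ‖x - y‖) :
    ∃ z, IsMove r σ v x y g z := by
  have hd := P.len_pos
  by_cases h1 : r + σ * v ≤ ‖x - y‖
  · by_cases hxg : x = g
    · refine ⟨x + (σ * v) • unitVec 0, Or.inl ⟨h1, ?_, fun h => absurd hxg h⟩⟩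
      rw [add_sub_cancel_left, norm_smul, norm_unitVec, mul_one, Real.norm_eq_abs, abs_of_pos hd]
    · exact ⟨_, Or.inl ⟨h1, norm_stepToward_sub hd.le hxg, fun _ => rfl⟩⟩
  · push Not at h1
    by_cases hE : x ≠ g ∧ EscapeLines r σ x y (stepToward (σ * v) x g)
    · exact ⟨_, Or.inr (Or.inl ⟨h1, hE.1, hE.2, rfl⟩)⟩
    · obtain ⟨q, hq⟩ := exists_isCcwPoint (r := r) hd (by linarith [P.four_mul_le])
        (by linarith [P.step_lt]) h1
      exact ⟨q, Or.inr (Or.inr ⟨h1, hE, hq⟩)⟩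

/-- The same normal serves again: the man gains at least σ along it, the lion at most σ, and the
next step toward an unchanged distant goal is the same vector. -/
theorem escapeNormal_move (P : MoveParams r σ v N R) {x y y' g ν : Plane} (hy : ‖y' - y‖ ≤ σ)
    (hR : R ≤ ‖x - g‖) (h : EscapeNormal r σ x y (stepToward (σ * v) x g) ν) :
    EscapeNormal r σ (stepToward (σ * v) x g) y'
      (stepToward (σ * v) (stepToward (σ * v) x g) g) ν := by
  obtain ⟨hν, h1, h2⟩ := h
  refine ⟨hν, ?_, ?_⟩
  · have h3 := inner_sub_le_of_norm_sub_le hν hy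
    have h5 : stepToward (σ * v) x g - y' =
      (stepToward (σ * v) x g - x) + (x - y) - (y' - y) := by abel
    rw [h5, inner_sub_left, inner_add_left]
    linarith
  · rw [stepToward_stepToward_sub P.len_pos.le (by rw [norm_sub_rev]; linarith [P.len_lt])]
    exact h2

/-- If the direction from the lion to the man nearly points to a distant goal, then the man can
escape. -/
theorem escapeNormal_of_cos (P : MoveParams r σ v N R) {x x₀ y y' g : Plane} {B ω : ℝ}
    (hx : x = circlePoint y r B) (hy : ‖y' - y‖ ≤ σ) (hω : g - x₀ = ‖g - x₀‖ • unitVec ω)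
    (hR₀ : R ≤ ‖x₀ - g‖) (hxx : ‖x - x₀‖ ≤ (N + 1) * (σ * v)) (hxg : x ≠ g)
    (hcos : 1 - (1 - 1 / v) / 2 ≤ cos (B - ω)) :
    EscapeNormal r σ x y' (stepToward (σ * v) x g) (unitVec B) := by
  have hν := norm_unitVec B
  refine ⟨hν, ?_, ?_⟩
  · have h1 := inner_sub_le_of_norm_sub_le hν hy
    have h2 : x - y' = r • unitVec B - (y' - y) := by rw [hx, circlePoint_eq]; abel
    rw [h2, inner_sub_left, real_inner_smul_left, real_inner_self_eq_norm_sq, hν]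
    linarith
  · have hg : 0 < ‖g - x‖ := norm_pos_iff.2 (sub_ne_zero.2 hxg.symm)
    rw [norm_sub_rev] at hR₀
    set ρ := ‖g - x₀‖
    set τ := 1 - 1 / v with hτ
    have hτ0 := P.frac_pos
    have hτ1 : 1 / v = 1 - τ := by rw [hτ]; ring
    have hv0 : 0 < 1 / v := one_div_pos.2 (by linarith [P.one_lt])
    have hs : ‖x - x₀‖ ≤ τ / 4 * ρ := hxx.trans (P.drift.trans (by gcongr))
    have hρ : 0 ≤ ρ := norm_nonneg _
    have hsplit : g - x = (g - x₀) - (x - x₀) := by abel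
    have hn : ‖g - x‖ ≤ ρ + τ / 4 * ρ := by
      rw [hsplit]; exact (norm_sub_le _ _).trans (by gcongr)
    have hi : ρ * (1 - τ / 2) - τ / 4 * ρ ≤ ⟪g - x, unitVec B⟫_ℝ := by
      rw [hsplit, inner_sub_left, hω, real_inner_smul_left, inner_unitVec, ← cos_neg, neg_sub]
      have := inner_sub_le_of_norm_sub_le hν hs
      have := mul_le_mul_of_nonneg_left hcos hρ
      linarith
    -- An escape needs the cosine of the angle between g − x and the normal to be at least 1/v = 1 −
    -- τ. The angle costs τ/2 and the drift from `x₀` costs τ/4, while the drift lengthens g − x by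
    -- a factor of at most 1 + τ/4; indeed (1 + τ/4)(1 − τ) ≤ 1 − 3τ/4.
    have hkey : ‖g - x‖ * (1 / v) ≤ ⟪g - x, unitVec B⟫_ℝ := by
      rw [hτ1] at hv0 ⊢
      nlinarith [mul_nonneg hρ hτ0.le, mul_nonneg (mul_nonneg hρ hτ0.le) hτ0.le]
    have hv : 0 < v := by linarith [P.one_lt]
    rw [stepToward, add_sub_cancel_left, real_inner_smul_left, div_mul_eq_mul_div, le_div_iff₀ hg]
    have := mul_le_mul_of_nonneg_left hkey P.len_pos.le
    calc σ * ‖g - x‖ = σ * v * (‖g - x‖ * (1 / v)) := by field_simp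
      _ ≤ _ := this

/-! ### Pursuit of a fixed goal and of a sequence of goals. -/

/-- There are at most `N` consecutive avoidance moves as long as the goal is far away. -/
theorem not_forall_isCcwMove (P : MoveParams r σ v N R) {x y : ℕ → Plane} {g : Plane}
    (hy : ∀ i, ‖y (i + 1) - y i‖ ≤ σ) (hR : ∀ i ≤ N, R ≤ ‖x i - g‖) :
    ¬ ∀ i ≤ N, IsCcwMove r σ v (x i) (y i) g (x (i + 1)) := by
  intro hm
  have hd := P.len_pos
  have hr := P.r_pos
  obtain ⟨-, -, θ, a, c, -, -, -, hq, -⟩ := hm 0 (Nat.zero_le _)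
  set B₀ := θ + a
  obtain ⟨ω', hω'⟩ := exists_polar (g - x 0)
  -- The angle of the goal direction is lifted to (B₀, B₀ + 2π], so a counterclockwise turn by 2π
  -- starting at B₀ must reach it.
  set ω := toIocMod two_pi_pos B₀ ω' with hωdef
  obtain ⟨hω1, hω2⟩ := toIocMod_mem_Ioc two_pi_pos B₀ ω'
  rw [← hωdef] at hω1 hω2
  have hω : g - x 0 = ‖g - x 0‖ • unitVec ω := by
    have := toIocMod_add_toIocDiv_zsmul two_pi_pos B₀ ω'
    rw [zsmul_eq_mul] at this
    rwa [← this, unitVec_add_int_mul] at hω'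
  have hdist : ∀ i ≤ N + 1, ‖x i - x 0‖ ≤ i * (σ * v) := by
    intro i
    induction i with
    | zero => simp
    | succ i ih =>
      intro hi
      have h1 := (hm i (by omega)).2.2.norm_sub hd.le
      have h2 := norm_sub_le_norm_sub_add_norm_sub (x (i + 1)) (x i) (x 0)
      have h3 := ih (by omega)
      push_cast
      linarith
  -- The angle cannot reach ω: the first overshoot is at most one turn, π(d + σ)/(2r), which by
  -- `P.angle` is small enough for escape lines. This would contradict the following avoidance move,
  -- hence the restriction i + 1 ≤ N.
  have hinv : ∀ i, i + 1 ≤ N → ∃ B, x (i + 1) = circlePoint (y i) r B ∧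
      B₀ + i * ((σ * v - σ) / r) ≤ B ∧ B < ω := by
    intro i
    induction i with
    | zero => exact fun _ => ⟨B₀, hq, by simp, hω1⟩
    | succ i ih =>
      intro hi
      obtain ⟨B, hB, hB1, hB2⟩ := ih (by omega)
      obtain ⟨B', hB', hB1', hB2'⟩ := (hm (i + 1) (by omega)).2.2.exists_angle hr P.step_pos.le
        P.step_lt hB (hy i)
      refine ⟨B', hB', by push_cast; linarith, ?_⟩
      by_contra! hcon
      have hxg : x (i + 1 + 1) ≠ g := by
        intro h
        have := hR (i + 1 + 1) hi
        rw [h, sub_self, norm_zero] at this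
        linarith [P.len_lt]
      refine (hm (i + 1 + 1) hi).2.1 ⟨hxg, P.escapeLines (P.escapeNormal_of_cos hB' (hy (i + 1)) hω
        (hR 0 (Nat.zero_le _)) ((hdist _ (by omega)).trans ?_) hxg ?_)⟩
      · gcongr
        exact_mod_cast (by omega : i + 1 + 1 ≤ N + 1)
      · have h1 := one_sub_sq_div_two_le_cos (x := B' - ω)
        have h2 : (B' - ω) ^ 2 ≤ (π * (σ * v + σ) / (2 * r)) ^ 2 :=
          pow_le_pow_left₀ (by linarith) (by linarith) 2
        linarith [P.angle]
  have hN : 1 < N := by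
    have h1 := P.turn
    have h2 := mul_pos two_pi_pos hr
    have h3 : 0 < (v - 1) * σ := mul_pos (by linarith [P.one_lt]) P.step_pos
    have h4 : (0 : ℝ) < N - 1 := by
      by_contra! h
      nlinarith
    exact_mod_cast (by linarith : (1 : ℝ) < N)
  obtain ⟨B, -, hB1, hB2⟩ := hinv (N - 1) (by omega)
  have h1 : 2 * π ≤ ((N - 1 : ℕ) : ℝ) * ((σ * v - σ) / r) := by
    rw [Nat.cast_sub hN.le, ← mul_div_assoc, le_div_iff₀ hr]
    have := P.turn
    push_cast
    linarith
  linarith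

/-- While the goal is fixed and far away, at most `N` steps are wasted. -/
theorem norm_sub_goal_le_of_far (P : MoveParams r σ v N R) {x y : ℕ → Plane} {g : Plane} {L : ℕ}
    (hy : ∀ i, ‖y (i + 1) - y i‖ ≤ σ) (hR : ∀ i < L, R ≤ ‖x i - g‖)
    (hm : ∀ i < L, IsMove r σ v (x i) (y i) g (x (i + 1))) :
    ‖x L - g‖ ≤ ‖x 0 - g‖ - L * (σ * v) + 2 * N * (σ * v) := by
  have hd := P.len_pos
  have hNd : 0 ≤ N * (σ * v) := by positivity
  have hstep : ∀ i < L, ∀ z, z = stepToward (σ * v) (x i) g → ‖z - g‖ = ‖x i - g‖ - σ * v := by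
    rintro i hi z rfl
    rw [norm_sub_rev, norm_sub_stepToward hd.le, norm_sub_rev]
    rw [norm_sub_rev]
    linarith [P.len_lt, hR i hi]
  have hrun : ∀ i ≤ L, ∀ j ≤ i, (∀ k, j ≤ k → k < i → IsCcwMove r σ v (x k) (y k) g (x (k + 1))) →
      i - j ≤ N := by
    intro i hi j hj hk
    by_contra! hcon
    exact P.not_forall_isCcwMove (x := fun k => x (j + k)) (y := fun k => y (j + k))
      (fun k => hy (j + k)) (fun k hkN => hR (j + k) (by omega))
      (fun k hkN => hk (j + k) (by omega) (by omega))
  have hne : ∀ i < L, x i ≠ g := by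
    intro i hi h
    have := hR i hi
    rw [h, sub_self, norm_zero] at this
    linarith [P.len_lt]
  -- Three phases: free moves only, without loss; a current block of avoidance moves since time j,
  -- each losing at most 2d; and, after an escape move, a permanent escape normal that excludes
  -- further avoidance moves.
  have hinv : ∀ i ≤ L, ‖x i - g‖ ≤ ‖x 0 - g‖ - i * (σ * v) ∨
      (∃ j < i, (∀ k, j ≤ k → k < i → IsCcwMove r σ v (x k) (y k) g (x (k + 1))) ∧
        ‖x i - g‖ ≤ ‖x 0 - g‖ - i * (σ * v) + 2 * (i - j : ℕ) * (σ * v)) ∨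
      ((∃ ν, EscapeNormal r σ (x i) (y i) (stepToward (σ * v) (x i) g) ν) ∧
        ‖x i - g‖ ≤ ‖x 0 - g‖ - i * (σ * v) + 2 * N * (σ * v)) := by
    intro i
    induction i with
    | zero => intro _; left; simp
    | succ i ih =>
      intro hi
      have hiL : i < L := hi
      have hgen : ‖x (i + 1) - g‖ ≤ ‖x i - g‖ + σ * v := by
        have := norm_sub_le_norm_sub_add_norm_sub (x (i + 1)) (x i) g
        rw [P.norm_move_sub (hm i hiL)] at this
        linarith
      push_cast
      rcases ih hiL.le with h | ⟨j, hj, hk, h⟩ | ⟨⟨ν, hν⟩, h⟩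
      · rcases hm i hiL with hf | he | hc
        · left
          rw [hstep i hiL _ (hf.2.2 (hne i hiL))]
          linarith
        · right; right
          obtain ⟨-, hxg, hE, hz⟩ := he
          obtain ⟨ν, hν⟩ := P.exists_escapeNormal hxg hE
          refine ⟨⟨ν, ?_⟩, ?_⟩
          · rw [hz]; exact P.escapeNormal_move (hy i) (hR i hiL) hν
          · rw [hstep i hiL _ hz]
            linarith
        · right; left
          refine ⟨i, i.lt_succ_self, fun k h1 h2 => ?_, ?_⟩
          · obtain rfl : k = i := by omega
            exact hc
          · rw [Nat.add_sub_cancel_left]; push_cast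
            linarith
      · rcases hm i hiL with hf | he | hc
        · have h1 := hk (i - 1) (by omega) (by omega)
          have h2 := hy (i - 1)
          rw [Nat.sub_add_cancel (by omega)] at h1 h2
          exact absurd hf (P.not_isFreeMove_of_isCcwMove h1 h2)
        · right; right
          obtain ⟨-, hxg, hE, hz⟩ := he
          obtain ⟨ν, hν⟩ := P.exists_escapeNormal hxg hE
          refine ⟨⟨ν, ?_⟩, ?_⟩
          · rw [hz]; exact P.escapeNormal_move (hy i) (hR i hiL) hν
          · rw [hstep i hiL _ hz]
            have h1 : ((i - j : ℕ) : ℝ) ≤ N := by exact_mod_cast hrun i hiL.le j hj.le hk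
            have h2 := mul_le_mul_of_nonneg_right h1 hd.le
            linarith
        · right; left
          refine ⟨j, by omega, fun k h1 h2 => ?_, ?_⟩
          · rcases Nat.lt_succ_iff_lt_or_eq.1 h2 with h3 | rfl
            · exact hk k h1 h3
            · exact hc
          · rw [Nat.succ_sub hj.le]
            push_cast
            linarith
      · have hz : x (i + 1) = stepToward (σ * v) (x i) g := by
          rcases hm i hiL with hf | he | hc
          · exact hf.2.2 (hne i hiL)
          · exact he.2.2.2
          · exact absurd ⟨hne i hiL, P.escapeLines hν⟩ hc.2.1
        right; right
        refine ⟨⟨ν, ?_⟩, ?_⟩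
        · rw [hz]; exact P.escapeNormal_move (hy i) (hR i hiL) hν
        · rw [hstep i hiL _ hz]
          linarith
  rcases hinv L le_rfl with h | ⟨j, hj, hk, h⟩ | ⟨-, h⟩
  · linarith
  · have h1 : ((L - j : ℕ) : ℝ) ≤ N := by exact_mod_cast hrun L le_rfl j hj.le hk
    have h2 := mul_le_mul_of_nonneg_right h1 hd.le
    linarith
  · exact h

/-- While the goal is fixed, the man either approaches it or stays close to it. -/
theorem norm_sub_goal_le (P : MoveParams r σ v N R) {x y : ℕ → Plane} {g : Plane} {L : ℕ}
    (hy : ∀ i, ‖y (i + 1) - y i‖ ≤ σ) (hm : ∀ i < L, IsMove r σ v (x i) (y i) g (x (i + 1))) :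
    ‖x L - g‖ ≤ ‖x 0 - g‖ - L * (σ * v) + 2 * N * (σ * v) ∨
      ‖x L - g‖ ≤ R + σ * v + 2 * N * (σ * v) := by
  have hd := P.len_pos
  -- The index j is 0 or comes just after the last visit to the disc of radius R about the goal;
  -- from j on the estimate for distant goals applies.
  have hlast : ∀ i ≤ L, ∃ j ≤ i, (∀ k, j ≤ k → k < i → R ≤ ‖x k - g‖) ∧
      (j = 0 ∨ ‖x j - g‖ ≤ R + σ * v) := by
    intro i
    induction i with
    | zero => exact fun _ => ⟨0, le_rfl, by intros; omega, Or.inl rfl⟩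
    | succ i ih =>
      intro hi
      obtain ⟨j, hj, hk, h⟩ := ih (by omega)
      by_cases hR : R ≤ ‖x i - g‖
      · refine ⟨j, by omega, fun k h1 h2 => ?_, h⟩
        rcases Nat.lt_succ_iff_lt_or_eq.1 h2 with h3 | rfl
        · exact hk k h1 h3
        · exact hR
      · refine ⟨i + 1, le_rfl, by intros; omega, Or.inr ?_⟩
        have := norm_sub_le_norm_sub_add_norm_sub (x (i + 1)) (x i) g
        rw [P.norm_move_sub (hm i hi)] at this
        linarith
  obtain ⟨j, hj, hk, h⟩ := hlast L le_rfl
  have hfar := P.norm_sub_goal_le_of_far (x := fun k => x (j + k)) (y := fun k => y (j + k))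
    (L := L - j) (fun k => hy (j + k)) (fun k hkL => hk (j + k) (by omega) (by omega))
    (fun k hkL => hm (j + k) (by omega))
  simp only [Nat.add_sub_of_le hj, add_zero] at hfar
  rcases h with rfl | h
  · left; simpa using hfar
  · right
    have : 0 ≤ ((L - j : ℕ) : ℝ) * (σ * v) := by positivity
    linarith

end MoveParams

/-- A man who pursues the points `G 1, G 2, …` by moves, each of them for `K` steps, stays close
to them. -/
theorem MoveParams.norm_sub_goal_seq_le {r σ v R a : ℝ} {N K : ℕ} (P : MoveParams r σ v N R)
    (hK : 0 < K) {x y G : ℕ → Plane} (hy : ∀ i, ‖y (i + 1) - y i‖ ≤ σ)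
    (hm : ∀ i, IsMove r σ v (x i) (y i) (G (i / K + 1)) (x (i + 1))) (h0 : x 0 = G 0)
    (hG : ∀ k, ‖G k - G (k + 1)‖ ≤ a) (ha : a + 2 * N * (σ * v) ≤ K * (σ * v)) (i : ℕ) :
    ‖x i - G (i / K + 1)‖ ≤ a + (R + σ * v + 4 * N * (σ * v)) := by
  have hd := P.len_pos
  have hR := P.len_lt
  have hNd : 0 ≤ N * (σ * v) := by positivity
  have ha0 : 0 ≤ a := (norm_nonneg _).trans (hG 0)
  have hperiod : ∀ k L, L ≤ K →
      ‖x (k * K + L) - G (k + 1)‖ ≤ ‖x (k * K) - G (k + 1)‖ - L * (σ * v) + 2 * N * (σ * v) ∨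
      ‖x (k * K + L) - G (k + 1)‖ ≤ R + σ * v + 2 * N * (σ * v) := by
    intro k L hL
    refine P.norm_sub_goal_le (x := fun j => x (k * K + j)) (y := fun j => y (k * K + j))
      (fun j => hy _) (fun j hj => ?_)
    have := hm (k * K + j)
    rwa [mul_comm k K, Nat.mul_add_div hK, Nat.div_eq_of_lt (by omega), add_zero,
      mul_comm K k] at this
  have hstart : ∀ k, ‖x (k * K) - G (k + 1)‖ ≤ ‖x (k * K) - G k‖ + a := fun k =>
    (norm_sub_le_norm_sub_add_norm_sub _ (G k) _).trans (by gcongr; exact hG k)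
  -- Changing the goal costs at most a, and the K following steps gain at least Kd − 2Nd ≥ a, so the
  -- bound survives each period.
  have hclose : ∀ k, ‖x (k * K) - G k‖ ≤ R + σ * v + 2 * N * (σ * v) := by
    intro k
    induction k with
    | zero => rw [zero_mul, h0, sub_self, norm_zero]; linarith
    | succ k ih =>
      have h1 := hstart k
      rw [Nat.succ_mul]
      rcases hperiod k K le_rfl with h | h
      · linarith
      · exact h
  have h1 := hperiod (i / K) (i % K) (Nat.mod_lt _ hK).le
  rw [mul_comm, Nat.div_add_mod, mul_comm] at h1
  have h2 := hstart (i / K)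
  have h3 := hclose (i / K)
  have h4 : 0 ≤ ((i % K : ℕ) : ℝ) * (σ * v) := by positivity
  rcases h1 with h | h <;> linarith

/-! ### Polygonal chains. -/

/-- The polygonal chain with corners `X 0, X 1, …` at the times `0, 1, …`. -/
noncomputable def chain (X : ℕ → Plane) (u : ℝ≥0) : Plane :=
  AffineMap.lineMap (X ⌊u⌋₊) (X (⌊u⌋₊ + 1)) ((u : ℝ) - ⌊u⌋₊)

theorem chain_add (X : ℕ → Plane) (i : ℕ) {s : ℝ≥0} (hs : s ≤ 1) :
    chain X (i + s) = AffineMap.lineMap (X i) (X (i + 1)) (s : ℝ) := by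
  rcases hs.lt_or_eq with h | rfl
  · have hf : ⌊(i : ℝ≥0) + s⌋₊ = i := by
      rw [Nat.floor_eq_iff zero_le]
      exact ⟨le_self_add, by gcongr⟩
    rw [chain, hf]; simp
  · have hf : ⌊(i : ℝ≥0) + 1⌋₊ = i + 1 := by
      exact_mod_cast Nat.floor_natCast (R := ℝ≥0) (i + 1)
    rw [chain, hf]; simp

theorem chain_natCast (X : ℕ → Plane) (i : ℕ) : chain X i = X i := by
  simpa using chain_add X i (s := 0) zero_le_one

theorem chain_congr {X Y : ℕ → Plane} {n : ℕ} (h : ∀ j ≤ n, X j = Y j) {u : ℝ≥0} (hu : u ≤ n) :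
    chain X u = chain Y u := by
  rcases hu.lt_or_eq with hu | rfl
  · have hf : ⌊u⌋₊ < n := (Nat.floor_lt zero_le).2 hu
    rw [chain, chain, h _ hf.le, h _ hf]
  · rw [chain_natCast, chain_natCast, h n le_rfl]

theorem norm_chain_sub_le {X : ℕ → Plane} {L : ℝ} (hX : ∀ i, ‖X (i + 1) - X i‖ ≤ L)
    (s t : ℝ≥0) : ‖chain X s - chain X t‖ ≤ L * |(s : ℝ) - t| := by
  wlog hst : t ≤ s generalizing s t
  · rw [norm_sub_rev, abs_sub_comm]; exact this t s (le_of_not_ge hst)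
  have hL : 0 ≤ L := (norm_nonneg _).trans (hX 0)
  have hst' : (t : ℝ) ≤ s := hst
  rw [abs_of_nonneg (by linarith)]
  have hfs : (⌊s⌋₊ : ℝ) ≤ s := by exact_mod_cast Nat.floor_le (zero_le (a := s))
  have hft : (t : ℝ) < ⌊t⌋₊ + 1 := by exact_mod_cast Nat.lt_floor_add_one t
  rcases (Nat.floor_mono hst).lt_or_eq with hlt | heq
  · have hcorner : ∀ j k, ‖X (j + k) - X j‖ ≤ k * L := by
      intro j k
      induction k with
      | zero => simp
      | succ k ih =>
        have h1 := norm_sub_le_norm_sub_add_norm_sub (X (j + k + 1)) (X (j + k)) (X j)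
        have h2 := hX (j + k)
        rw [← add_assoc]; push_cast
        linarith
    have h1 : ‖chain X s - X ⌊s⌋₊‖ ≤ (s - ⌊s⌋₊) * L := by
      rw [chain, AffineMap.lineMap_apply_module', add_sub_cancel_right, norm_smul,
        Real.norm_eq_abs, abs_of_nonneg (by linarith)]
      exact mul_le_mul_of_nonneg_left (hX _) (by linarith)
    have h2 : ‖X (⌊t⌋₊ + 1) - chain X t‖ ≤ (⌊t⌋₊ + 1 - t) * L := by
      have : X (⌊t⌋₊ + 1) - chain X t =
          ((⌊t⌋₊ : ℝ) + 1 - t) • (X (⌊t⌋₊ + 1) - X ⌊t⌋₊) := by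
        rw [chain, AffineMap.lineMap_apply_module']; module
      rw [this, norm_smul, Real.norm_eq_abs, abs_of_nonneg (by linarith)]
      exact mul_le_mul_of_nonneg_left (hX _) (by linarith)
    have h3 := hcorner (⌊t⌋₊ + 1) (⌊s⌋₊ - (⌊t⌋₊ + 1))
    rw [Nat.add_sub_of_le hlt, Nat.cast_sub hlt] at h3
    push_cast at h3
    have h4 := norm_sub_le_norm_sub_add_norm_sub (chain X s) (X ⌊s⌋₊) (chain X t)
    have h5 := norm_sub_le_norm_sub_add_norm_sub (X ⌊s⌋₊) (X (⌊t⌋₊ + 1)) (chain X t)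
    linarith
  · have : chain X s - chain X t = ((s : ℝ) - t) • (X (⌊s⌋₊ + 1) - X ⌊s⌋₊) := by
      rw [chain, chain, heq, AffineMap.lineMap_apply_module', AffineMap.lineMap_apply_module']
      module
    rw [this, norm_smul, Real.norm_eq_abs, abs_of_nonneg (by linarith), mul_comm]
    exact mul_le_mul_of_nonneg_right (hX _) (by linarith)

theorem norm_chain_div_sub_le {X : ℕ → Plane} {σ : ℝ≥0} (hσ : 0 < σ) {v : ℝ}
    (hX : ∀ i, ‖X (i + 1) - X i‖ ≤ σ * v) (s t : ℝ≥0) :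
    ‖chain X (s / σ) - chain X (t / σ)‖ ≤ v * |(s : ℝ) - t| := by
  have hσ' : (0 : ℝ) < σ := hσ
  refine (norm_chain_sub_le hX _ _).trans_eq ?_
  rw [NNReal.coe_div, NNReal.coe_div, ← sub_div, abs_div, abs_of_pos hσ']
  field_simp

theorem isEqualPolygonal_chain {X : ℕ → Plane} {σ : ℝ≥0} (hσ : 0 < σ) {v : ℝ}
    (hX : ∀ i, ‖X (i + 1) - X i‖ = σ * v) :
    IsEqualPolygonal (fun t => chain X (t / σ)) σ v := by
  intro i
  have hc : ∀ i : ℕ, chain X (i * σ / σ) = X i := fun i => by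
    rw [mul_div_cancel_right₀ _ hσ.ne', chain_natCast]
  have hc' : chain X ((i + 1) * σ / σ) = X (i + 1) := by exact_mod_cast hc (i + 1)
  refine ⟨?_, fun s hs => ?_⟩
  · simp only [hc, hc']
    exact hX i
  · simp only [hc, hc']
    rw [mul_div_cancel_right₀ _ hσ.ne']
    exact chain_add X i hs

/-- A man path is only known to be (1 + ε)-Lipschitz; this recovers the smaller speed of the old
strategy, which the new man must exceed. -/
theorem IsEqualPolygonal.norm_sub_le {m : ℝ≥0 → Plane} {σ : ℝ≥0} {v : ℝ} (hσ : 0 < σ)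
    (h : IsEqualPolygonal m σ v) (s t : ℝ≥0) : ‖m s - m t‖ ≤ v * |(s : ℝ) - t| := by
  have hm : ∀ t, m t = chain (fun i => m (i * σ)) (t / σ) := by
    intro t
    have h1 : t / σ = (⌊t / σ⌋₊ : ℝ≥0) + (t / σ - ⌊t / σ⌋₊) :=
      (add_tsub_cancel_of_le (Nat.floor_le zero_le)).symm
    have h2 : t / σ - ⌊t / σ⌋₊ ≤ 1 := by
      rw [tsub_le_iff_right, add_comm]; exact (Nat.lt_floor_add_one _).le
    rw [h1, chain_add _ _ h2, Nat.cast_add_one, ← (h _).2 _ h2, ← h1, div_mul_cancel₀ _ hσ.ne']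
  rw [hm s, hm t]
  exact norm_chain_div_sub_le hσ (fun i => by simpa using (h i).1.le) s t

/-! ### Paths composed of moves. -/

/-- The position of the man after a move. -/
noncomputable def moveChoice (r σ v : ℝ) (x y g : Plane) : Plane :=
  open Classical in
  if h : ∃ z, IsMove r σ v x y g z then h.choose else x + (σ * v) • unitVec 0

/-- The successive positions of a man who starts at `m₀` and moves with respect to lion positions
`y i` and goals `g i`. -/
noncomputable def corners (r σ v : ℝ) (m₀ : Plane) (y g : ℕ → Plane) : ℕ → Plane
  | 0 => m₀
  | i + 1 => moveChoice r σ v (corners r σ v m₀ y g i) (y i) (g i)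

theorem corners_congr {r σ v : ℝ} {m₀ : Plane} {y g y' g' : ℕ → Plane} {n : ℕ}
    (hy : ∀ i < n, y i = y' i) (hg : ∀ i < n, g i = g' i) :
    ∀ i ≤ n, corners r σ v m₀ y g i = corners r σ v m₀ y' g' i := by
  intro i
  induction i with
  | zero => exact fun _ => rfl
  | succ i ih => intro hi; rw [corners, corners, ih (by omega), hy i hi, hg i hi]

theorem MoveParams.norm_corners_sub {r σ v R : ℝ} {N : ℕ} (P : MoveParams r σ v N R) (m₀ : Plane)
    (y g : ℕ → Plane) (i : ℕ) :
    ‖corners r σ v m₀ y g (i + 1) - corners r σ v m₀ y g i‖ = σ * v := by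
  rw [corners, moveChoice]
  split_ifs with h
  · exact P.norm_move_sub h.choose_spec
  -- The default step also has length d, so the corners form an equal-step chain without any
  -- assumption on the lion positions.
  · rw [add_sub_cancel_left, norm_smul, norm_unitVec, mul_one, Real.norm_eq_abs,
      abs_of_pos P.len_pos]

theorem MoveParams.le_norm_corners_sub {r σ v R : ℝ} {N : ℕ} (P : MoveParams r σ v N R)
    {m₀ : Plane} {y : ℕ → Plane} (g : ℕ → Plane) (h0 : r - σ ≤ ‖m₀ - y 0‖)
    (hy : ∀ i, ‖y (i + 1) - y i‖ ≤ σ) (i : ℕ) : r - σ ≤ ‖corners r σ v m₀ y g i - y i‖ := by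
  induction i with
  | zero => exact h0
  | succ i ih =>
    have h := P.exists_move (g i) ih
    rw [corners, moveChoice, dif_pos h]
    exact P.le_norm_move_sub h.choose_spec (hy i)

theorem MoveParams.isMove_corners {r σ v R : ℝ} {N : ℕ} (P : MoveParams r σ v N R)
    {m₀ : Plane} {y : ℕ → Plane} (g : ℕ → Plane) (h0 : r - σ ≤ ‖m₀ - y 0‖)
    (hy : ∀ i, ‖y (i + 1) - y i‖ ≤ σ) (i : ℕ) :
    IsMove r σ v (corners r σ v m₀ y g i) (y i) (g i) (corners r σ v m₀ y g (i + 1)) := by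
  have h := P.exists_move (g i) (P.le_norm_corners_sub g h0 hy i)
  rw [corners, moveChoice, dif_pos h]
  exact h.choose_spec

/-! ### Choice of the parameters. -/

/-- The radius r is chosen before the step. N is about 2πr/((v − 1)σ), so (N + 1)d ≤ C r for every
small σ; R is then a multiple of r, and all errors shrink with r. -/
theorem exists_moveParams {v D h η : ℝ} (hv : 1 < v) (hD : 0 < D) (hh : 0 < h) (hη : 0 < η) :
    ∃ (r : ℝ) (K N : ℕ) (R : ℝ), r ≤ D ∧ 0 < K ∧ MoveParams r (h / K) v N R ∧
      R + h / K * v + 4 * N * (h / K * v) ≤ η := by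
  have hv0 : 0 < v := by linarith
  have hv1 : 0 < v - 1 := by linarith
  set τ := 1 - 1 / v with hτ
  have hτ0 : 0 < τ := by
    have := (div_lt_one hv0).2 hv
    linarith
  have hτ1 : τ < 1 := by
    have := one_div_pos.2 hv0
    linarith
  -- The 3 comes from N + 1 ≤ 2πr/((v − 1)σ) + 3 together with d ≤ r.
  set C := 2 * π * v / (v - 1) + 3 with hC
  have hC0 : 0 < C := by positivity
  -- The summands bound R, d and 4Nd, each divided by r.
  set C' := 4 * C / τ + 1 + 4 * C with hC'
  have hC'0 : 0 < C' := by positivity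
  set r := min D (η / C') with hr
  have hr0 : 0 < r := lt_min hD (div_pos hη hC'0)
  -- With σ ≤ κr, the first entry gives 4d ≤ r. The second bounds the largest turn by τ, whose
  -- square is at most τ because τ < 1.
  set κ := min (1 / (4 * v)) (2 * τ / (π * (v + 1))) with hκ
  have hκ0 : 0 < κ := by rw [hκ]; positivity
  obtain ⟨K, hK⟩ := exists_nat_gt (h / (κ * r))
  have hK0 : (0 : ℝ) < K := lt_trans (by positivity) hK
  set σ := h / K with hσ
  have hσ0 : 0 < σ := by positivity
  have hσκ : σ ≤ κ * r := by
    rw [div_lt_iff₀ (by positivity)] at hK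
    rw [hσ, div_le_iff₀ hK0]; linarith
  have h4 : 4 * (σ * v) ≤ r := by
    have h1 : σ ≤ 1 / (4 * v) * r := hσκ.trans (by gcongr; exact min_le_left _ _)
    calc 4 * (σ * v) ≤ 4 * (1 / (4 * v) * r * v) := by gcongr
      _ = r := by field_simp
  set N := ⌈2 * π * r / ((v - 1) * σ)⌉₊ + 1 with hN
  have hN1 : 2 * π * r / ((v - 1) * σ) ≤ (N : ℝ) - 1 := by
    rw [hN]; push_cast; rw [add_sub_cancel_right]; exact Nat.le_ceil _
  have hN2 : (N : ℝ) ≤ 2 * π * r / ((v - 1) * σ) + 2 := by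
    have := Nat.ceil_lt_add_one (show 0 ≤ 2 * π * r / ((v - 1) * σ) by positivity)
    rw [hN]; push_cast; linarith
  have hNd : ((N : ℝ) + 1) * (σ * v) ≤ C * r := by
    calc ((N : ℝ) + 1) * (σ * v) ≤ (2 * π * r / ((v - 1) * σ) + 3) * (σ * v) := by
          refine mul_le_mul_of_nonneg_right ?_ (by positivity)
          linarith
      _ = 2 * π * v / (v - 1) * r + 3 * (σ * v) := by field_simp
      _ ≤ C * r := by rw [hC]; linarith
  have hd0 : 0 < σ * v := by positivity
  refine ⟨r, K, N, 4 * C / τ * r, min_le_left _ _, by exact_mod_cast hK0,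
    ⟨hσ0, hv, h4, ?_, ?_, ?_⟩, ?_⟩
  · rwa [div_le_iff₀ (by positivity)] at hN1
  · refine hNd.trans_eq ?_
    rw [← hτ]; field_simp
  · have h1 : σ ≤ 2 * τ / (π * (v + 1)) * r := hσκ.trans (by gcongr; exact min_le_right _ _)
    have h2 : π * (σ * v + σ) / (2 * r) ≤ τ := by
      rw [div_le_iff₀ (by positivity)]
      calc π * (σ * v + σ) = π * (v + 1) * σ := by ring
        _ ≤ π * (v + 1) * (2 * τ / (π * (v + 1)) * r) := by gcongr
        _ = τ * (2 * r) := by field_simp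
    have h3 : 0 ≤ π * (σ * v + σ) / (2 * r) := by positivity
    nlinarith
  · have h1 : C' * r ≤ η := by
      calc C' * r ≤ C' * (η / C') := by gcongr; exact min_le_right _ _
        _ = η := by field_simp
    have h2 : C' * r = 4 * C / τ * r + r + 4 * (C * r) := by rw [hC']; ring
    linarith

/-! ### Strategies against one lion and against one more lion. -/

/-- A strategy that makes its decisions at the multiples of `σ`. -/
def ManStrategy.ofEquitemporal {ε : ℝ} {m₀ : Plane} {ι : Type} {l₀ : ι → Plane}
    (F : (∀ i, LionPath (l₀ i)) → ManPath ε m₀) (σ : ℝ≥0) (hσ : 0 < σ)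
    (hF : ∀ (i : ℕ) (l l' : ∀ j, LionPath (l₀ j)), (∀ j, ∀ s ≤ i * σ, l j s = l' j s) →
      ∀ s ≤ (i + 1) * σ, F l s = F l' s) : ManStrategy ε m₀ l₀ where
  toFun := F
  causal l l' t h s hs := by
    rcases eq_zero_or_pos t with rfl | ht
    · obtain rfl : s = 0 := le_antisymm hs zero_le
      rw [(F l).start, (F l').start]
    · have hc : 0 < ⌈t / σ⌉₊ := Nat.ceil_pos.2 (div_pos ht hσ)
      -- This is the last decision time strictly before t, since the lions are only known to agree
      -- before t.
      refine hF (⌈t / σ⌉₊ - 1) l l' (fun j u hu => h j u (hu.trans_lt ?_)) s (hs.trans ?_)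
      · rw [← lt_div_iff₀ hσ]
        exact Nat.lt_ceil.1 (by omega)
      · rw [← div_le_iff₀ hσ, ← Nat.cast_add_one, Nat.sub_add_cancel hc]
        exact Nat.le_ceil _

theorem excess_nonneg {ε : ℝ} (hε : 0 < ε) (n : ℕ) : 0 ≤ excess ε n := by
  have : (1 : ℝ) / 2 ^ n ≤ 1 := by
    rw [div_le_one (by positivity)]; exact one_le_pow₀ one_le_two
  exact mul_nonneg (by linarith) hε.le

theorem excess_lt_succ {ε : ℝ} (hε : 0 < ε) (n : ℕ) : excess ε n < excess ε (n + 1) := by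
  have : (1 : ℝ) / 2 ^ (n + 1) < 1 / 2 ^ n := by
    gcongr
    · exact one_lt_two
    · omega
  exact mul_lt_mul_of_pos_right (by linarith) hε

theorem excess_le {ε : ℝ} (hε : 0 < ε) (n : ℕ) : excess ε n ≤ ε := by
  have : (0 : ℝ) < 1 / 2 ^ n := by positivity
  unfold excess
  nlinarith

/-- The man path along a polygonal chain. -/
noncomputable def chainPath {ε : ℝ} {m₀ : Plane} (X : ℕ → Plane) (σ : ℝ≥0) (hσ : 0 < σ) (v : ℝ)
    (hv : v ≤ 1 + ε) (h0 : X 0 = m₀) (hX : ∀ i, ‖X (i + 1) - X i‖ = σ * v) : ManPath ε m₀ where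
  toFun t := chain X (t / σ)
  start := by rw [zero_div]; exact_mod_cast (chain_natCast X 0).trans h0
  speed s t := (norm_chain_div_sub_le hσ (fun i => (hX i).le) s t).trans (by gcongr)

theorem PathFrom.norm_sub_le_of_le {v : ℝ} {x₀ : Plane} (f : PathFrom v x₀) {s t a : ℝ≥0}
    (hv : 0 ≤ v) (hst : s ≤ t) (ht : t ≤ s + a) : ‖f t - f s‖ ≤ v * a := by
  have h1 : (s : ℝ) ≤ t := hst
  have h2 : (t : ℝ) ≤ s + a := by exact_mod_cast ht
  refine (f.speed t s).trans ?_
  rw [abs_of_nonneg (by linarith)]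
  gcongr
  linarith

/-- A man who runs away from the starting point of the first lion is never caught by it. -/
theorem exists_strategy_one {ε : ℝ} (hε : 0 < ε) (m₀ : Plane) (l₀ : ℕ → Plane)
    (hl : l₀ 1 ≠ m₀) :
    ∃ M : StrategyAgainst ε m₀ l₀ 1, ∃ c : ℝ, 0 < c ∧
      (∀ (l : ∀ i, LionPath (l₀ i)) (t : ℝ≥0), c ≤ ‖M.run l t - l 1 t‖) ∧
      M.IsEquitemporal 1 ∧
      ∀ l : ∀ i, LionPath (l₀ i), IsEqualPolygonal (M.run l) 1 (1 + excess ε 1) := by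
  set v := 1 + excess ε 1 with hvdef
  have hv1 : 1 ≤ v := by linarith [excess_nonneg hε 1]
  obtain ⟨θ, hθ⟩ := exists_polar (m₀ - l₀ 1)
  have hc : 0 < ‖m₀ - l₀ 1‖ := norm_pos_iff.2 (sub_ne_zero.2 hl.symm)
  set D := ‖m₀ - l₀ 1‖
  let X : ℕ → Plane := fun i => m₀ + ((i : ℝ) * v) • unitVec θ
  have hX : ∀ i, ‖X (i + 1) - X i‖ = (1 : ℝ≥0) * v := by
    intro i
    have : X (i + 1) - X i = v • unitVec θ := by
      simp only [X]; push_cast; module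
    rw [this, norm_smul, norm_unitVec, Real.norm_eq_abs, abs_of_nonneg (by linarith)]; simp
  have hchain : ∀ t : ℝ≥0, chain X (t / 1) = m₀ + ((t : ℝ) * v) • unitVec θ := by
    intro t
    rw [div_one, chain, AffineMap.lineMap_apply_module']
    simp only [X]; push_cast; module
  let m : ManPath ε m₀ := chainPath X 1 one_pos v (by linarith [excess_le hε 1])
    (by simp [X]) hX
  refine ⟨ManStrategy.ofEquitemporal (fun _ => m) 1 one_pos (fun _ _ _ _ _ _ => rfl), D,
    hc, ?_, ⟨one_pos, fun _ _ _ _ _ _ => rfl⟩,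
    fun l => isEqualPolygonal_chain one_pos hX⟩
  intro l t
  have h1 : ‖l 1 t - l₀ 1‖ ≤ t := by
    have := (l 1).speed t 0
    rw [(l 1).start] at this
    simpa using this
  have h2 : ‖chain X (t / 1) - l₀ 1‖ = D + t * v := by
    have : chain X (t / 1) - l₀ 1 = (D + t * v) • unitVec θ := by
      rw [hchain, add_smul, ← hθ]; abel
    rw [this, norm_smul, norm_unitVec, mul_one, Real.norm_eq_abs, abs_of_nonneg (by positivity)]
  have h3 := norm_sub_le_norm_sub_add_norm_sub (chain X (t / 1)) (l 1 t) (l₀ 1)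
  have h4 : (t : ℝ) ≤ t * v := le_mul_of_one_le_right t.2 hv1
  change D ≤ ‖chain X (t / 1) - l 1 t‖
  linarith

/-- A strategy against `n` lions can be modified to evade one more lion. -/
theorem exists_strategy_succ {ε : ℝ} (hε : 0 < ε) {m₀ : Plane} {l₀ : ℕ → Plane} {n : ℕ}
    (hl : l₀ (n + 1) ≠ m₀) {M : StrategyAgainst ε m₀ l₀ n} {σ' : ℝ≥0}
    (hM : M.IsEquitemporal σ')
    (hpoly : ∀ l : ∀ i, LionPath (l₀ i), IsEqualPolygonal (M.run l) σ' (1 + excess ε n))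
    {δ : ℝ} (hδ : 0 < δ) :
    ∃ (M' : StrategyAgainst ε m₀ l₀ (n + 1)) (c r : ℝ) (σ : ℝ≥0) (p : ℕ),
      0 < c ∧
      (∀ (l : ∀ i, LionPath (l₀ i)) (t : ℝ≥0), c ≤ ‖M'.run l t - l (n + 1) t‖) ∧
      (∀ (l : ∀ i, LionPath (l₀ i)) (t : ℝ≥0), ‖M.run l t - M'.run l t‖ ≤ δ) ∧
      M'.IsEquitemporal σ ∧
      (∀ l : ∀ i, LionPath (l₀ i), IsEqualPolygonal (M'.run l) σ (1 + excess ε (n + 1))) ∧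
      0 < r ∧ 0 < p ∧ σ' * (1 + excess ε n) / p ≤ δ / 2 ∧
      ∀ l : ∀ i, LionPath (l₀ i),
        FollowsByMoves r σ (1 + excess ε (n + 1)) (σ' / p) (M.run l) (l (n + 1)) (M'.run l) := by
  set v' := 1 + excess ε n with hv'
  set v := 1 + excess ε (n + 1) with hv
  have hv'1 : 1 ≤ v' := by linarith [excess_nonneg hε n]
  have hvv : v' < v := by linarith [excess_lt_succ hε n]
  have hvε : v ≤ 1 + ε := by linarith [excess_le hε (n + 1)]
  have hσ' : 0 < σ' := hM.1
  have hσ'0 : (0 : ℝ) < σ' := hσ'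
  obtain ⟨p, hp⟩ := exists_nat_gt (4 * (σ' * v') / δ)
  have hp0 : (0 : ℝ) < p := lt_of_le_of_lt (by positivity) hp
  have hpN : 0 < p := by exact_mod_cast hp0
  have hpδ : σ' * v' / p ≤ δ / 4 := by
    rw [div_lt_iff₀ hδ] at hp
    rw [div_le_iff₀ hp0]; linarith
  set h : ℝ≥0 := σ' / p with hh
  have hhσ : h * p = σ' := div_mul_cancel₀ _ (by exact_mod_cast hpN.ne')
  have hh0 : 0 < h := div_pos hσ' (by exact_mod_cast hpN)
  have hh0' : (0 : ℝ) < h := hh0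
  have ha : h * v' ≤ δ / 4 := by
    refine le_trans (le_of_eq ?_) hpδ
    rw [hh]; push_cast; ring
  -- The first bound lets the surplus h(v − v') of one period cover the loss 2Nd; the second is one
  -- quarter of the tolerance.
  have hη : 0 < min (h * (v - v')) (δ / 4) :=
    lt_min (mul_pos hh0' (by linarith)) (by linarith)
  have hD : 0 < ‖m₀ - l₀ (n + 1)‖ := norm_pos_iff.2 (sub_ne_zero.2 hl.symm)
  obtain ⟨r, K, N, R, hrD, hK, P, hsmall⟩ :=
    exists_moveParams (by linarith : 1 < v) hD hh0' hη
  have hη1 := hsmall.trans (min_le_left _ _)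
  have hη2 := hsmall.trans (min_le_right _ _)
  set σ : ℝ≥0 := h / K with hσ
  have hσcoe : (h / K : ℝ) = σ := by rw [hσ]; push_cast; rfl
  rw [hσcoe] at P hη1 hη2
  have hσ0 : 0 < σ := P.step_pos
  have hσK : K * σ = h := mul_div_cancel₀ _ (by exact_mod_cast hK.ne')
  have hKd : (K : ℝ) * (σ * v) = h * v := by
    rw [← hσK]; push_cast; ring
  have hd := P.len_pos
  have hσd := P.step_lt
  have hRd := P.len_lt
  have hNd : 0 ≤ N * (σ * v) := by positivity
  have hnext : ∀ i : ℕ, nextMultiple h (i * σ) = ((i / K + 1 : ℕ) : ℝ≥0) * h := by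
    intro i
    have : (i : ℝ≥0) * σ / h = i / K := by
      rw [← hσK, mul_div_mul_right _ _ hσ0.ne']
    rw [nextMultiple, this, Nat.floor_div_eq_div]
    push_cast; rfl
  let Y : (∀ i : Set.Icc 1 (n + 1), LionPath (l₀ i)) → ℕ → Plane :=
    fun l i => l ⟨n + 1, by simp⟩ (i * σ)
  let G : (∀ i : Set.Icc 1 (n + 1), LionPath (l₀ i)) → ℕ → Plane :=
    fun l k => M.toFun (fun i => l ⟨i, i.2.1, i.2.2.trans n.le_succ⟩) (k * h)
  let X : (∀ i : Set.Icc 1 (n + 1), LionPath (l₀ i)) → ℕ → Plane :=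
    fun l => corners r σ v m₀ (Y l) (fun i => G l (i / K + 1))
  let F : (∀ i : Set.Icc 1 (n + 1), LionPath (l₀ i)) → ManPath ε m₀ :=
    fun l => chainPath (X l) σ hσ0 v hvε rfl (P.norm_corners_sub _ _ _)
  have hF : ∀ (i : ℕ) (l l' : ∀ j : Set.Icc 1 (n + 1), LionPath (l₀ j)),
      (∀ j, ∀ s ≤ i * σ, l j s = l' j s) → ∀ s ≤ (i + 1) * σ, F l s = F l' s := by
    intro i l l' hll s hs
    refine chain_congr (n := i + 1) (corners_congr ?_ ?_) ?_
    · intro k hk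
      refine hll _ _ ?_
      gcongr
      omega
    · intro k hk
      -- The goal of step k lies at time (k/K + 1)h, before or at the old decision time with index
      -- k/K/p + 1. It therefore depends on the lions only up to the old decision time with index
      -- k/K/p, which is not after kσ.
      refine hM.2 (k / K / p) _ _ (fun j s hs => hll _ _ (hs.trans ?_)) _ ?_
      · have h1 : k / K / p * (p * K) ≤ i := by
          rw [Nat.div_div_eq_div_mul, mul_comm K p]
          exact (Nat.div_mul_le_self _ _).trans (by omega)
        calc ((k / K / p : ℕ) : ℝ≥0) * σ' = ((k / K / p * (p * K) : ℕ) : ℝ≥0) * σ := by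
              rw [← hhσ, ← hσK]; push_cast; ring
          _ ≤ i * σ := by gcongr
      · have h1 : k / K + 1 ≤ (k / K / p + 1) * p := by
          rw [mul_comm]; exact Nat.lt_mul_div_succ _ hpN
        calc ((k / K + 1 : ℕ) : ℝ≥0) * h ≤ (((k / K / p + 1) * p : ℕ) : ℝ≥0) * h := by gcongr
          _ = _ := by rw [← hhσ]; push_cast; ring
    · rw [div_le_iff₀ hσ0]; exact_mod_cast hs
  let M' : StrategyAgainst ε m₀ l₀ (n + 1) := ManStrategy.ofEquitemporal F σ hσ0 hF
  have hrun : ∀ (l : ∀ i, LionPath (l₀ i)) (t : ℝ≥0),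
      M'.run l t = chain (X fun i => l i) (t / σ) := fun _ _ => rfl
  have hY : ∀ (l : ∀ i, LionPath (l₀ i)) (i : ℕ),
      ‖Y (fun i => l i) (i + 1) - Y (fun i => l i) i‖ ≤ σ := by
    intro l i
    have := (l (n + 1)).norm_sub_le_of_le (s := i * σ) (t := (i + 1 : ℕ) * σ) (a := σ)
      zero_le_one (by gcongr; omega) (by push_cast; rw [add_mul, one_mul])
    rwa [one_mul] at this
  have hstart : ∀ l : ∀ i, LionPath (l₀ i), r - σ ≤ ‖m₀ - Y (fun i => l i) 0‖ := by
    intro l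
    have : Y (fun i => l i) 0 = l₀ (n + 1) := by simp [Y, (l (n + 1)).start]
    rw [this]; linarith [P.step_pos]
  have hmove := fun (l : ∀ i, LionPath (l₀ i)) => P.isMove_corners
    (fun i => G (fun i => l i) (i / K + 1)) (hstart l) (hY l)
  have hfloor : ∀ t : ℝ≥0, (⌊t / σ⌋₊ : ℝ≥0) * σ ≤ t ∧ t ≤ ⌊t / σ⌋₊ * σ + σ := by
    intro t
    constructor
    · rw [← le_div_iff₀ hσ0]; exact Nat.floor_le zero_le
    · rw [← add_one_mul, ← div_le_iff₀ hσ0]; exact (Nat.lt_floor_add_one _).le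
  have hnear : ∀ (l : ∀ i, LionPath (l₀ i)) (t : ℝ≥0),
      ‖M'.run l t - X (fun i => l i) ⌊t / σ⌋₊‖ ≤ σ * v := by
    intro l t
    obtain ⟨h1, h2⟩ := hfloor t
    have h3 : (⌊t / σ⌋₊ : ℝ) * σ ≤ t := by exact_mod_cast h1
    have h4 : (t : ℝ) ≤ ⌊t / σ⌋₊ * σ + σ := by exact_mod_cast h2
    have h5 := norm_chain_div_sub_le hσ0 (fun i => (P.norm_corners_sub m₀ (Y fun i => l i)
      (fun i => G (fun i => l i) (i / K + 1)) i).le) t (⌊t / σ⌋₊ * σ)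
    rw [mul_div_cancel_right₀ _ hσ0.ne', chain_natCast] at h5
    refine h5.trans ?_
    push_cast
    rw [abs_of_nonneg (by linarith), mul_comm]
    exact mul_le_mul_of_nonneg_right (by linarith) (by linarith)
  refine ⟨M', σ * v, r, σ, p, hd, ?_, ?_, ⟨hσ0, hF⟩,
    fun l => isEqualPolygonal_chain hσ0 (P.norm_corners_sub _ _ _), P.r_pos, hpN, by linarith, ?_⟩
  -- Between decision times the bound r − σ decreases by at most d + σ, and r ≥ 4d with σ < d leaves
  -- at least d.
  · intro l t
    obtain ⟨h1, h2⟩ := hfloor t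
    have h3 := P.le_norm_corners_sub (fun i => G (fun i => l i) (i / K + 1)) (hstart l) (hY l)
      ⌊t / σ⌋₊
    have h4 : ‖l (n + 1) t - l (n + 1) (⌊t / σ⌋₊ * σ)‖ ≤ σ := by
      simpa using (l (n + 1)).norm_sub_le_of_le zero_le_one h1 h2
    have h5 := hnear l t
    change r - σ ≤ ‖X (fun i => l i) ⌊t / σ⌋₊ - l (n + 1) (⌊t / σ⌋₊ * σ)‖ at h3
    have h6 := norm_sub_le_norm_sub_add_norm_sub (X (fun i => l i) ⌊t / σ⌋₊) (M'.run l t)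
      (l (n + 1) (⌊t / σ⌋₊ * σ))
    have h7 := norm_sub_le_norm_sub_add_norm_sub (M'.run l t) (l (n + 1) t)
      (l (n + 1) (⌊t / σ⌋₊ * σ))
    rw [norm_sub_rev (X (fun i => l i) ⌊t / σ⌋₊) (M'.run l t)] at h6
    linarith [P.four_mul_le]
  -- Four errors of at most δ/4 add up: from the man to his last corner, from there to the goal in
  -- the two terms hv' and η, and from the goal back to the old path.
  · intro l t
    have hGstep : ∀ k, ‖G (fun i => l i) k - G (fun i => l i) (k + 1)‖ ≤ h * v' := by
      intro k
      refine ((hpoly l).norm_sub_le hσ' (k * h) ((k + 1 : ℕ) * h)).trans_eq ?_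
      push_cast
      rw [show (k : ℝ) * h - (k + 1) * h = -h by ring, abs_neg, abs_of_pos hh0', mul_comm]
    have hG0 : m₀ = G (fun i => l i) 0 := by
      simp only [G, Nat.cast_zero, zero_mul]
      exact (M.run l).start.symm
    set i := ⌊t / σ⌋₊ with hi
    have hgoal := P.norm_sub_goal_seq_le hK (hY l) (hmove l) hG0 hGstep
      (by rw [hKd]; linarith) i
    have h1 := hnear l t
    obtain ⟨h2, h3⟩ := hfloor t
    have h4 : ‖G (fun i => l i) (i / K + 1) - M.run l t‖ ≤ h * v' := by
      refine ((hpoly l).norm_sub_le hσ' ((i / K + 1 : ℕ) * h) t).trans ?_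
      rw [mul_comm]
      refine mul_le_mul_of_nonneg_right ?_ (by linarith)
      have h5 : ((i / K : ℕ) : ℝ≥0) * h ≤ t := by
        refine le_trans ?_ h2
        rw [← hσK, ← mul_assoc]
        gcongr
        exact_mod_cast Nat.div_mul_le_self i K
      have h6 : t ≤ ((i / K + 1 : ℕ) : ℝ≥0) * h := by
        refine h3.trans ?_
        rw [← hσK, ← mul_assoc, ← add_one_mul]
        gcongr
        have : i + 1 ≤ (i / K + 1) * K := by
          rw [mul_comm]; exact Nat.lt_mul_div_succ _ hK
        exact_mod_cast this
      have h5' : ((i / K : ℕ) : ℝ) * h ≤ t := by exact_mod_cast h5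
      have h6' : (t : ℝ) ≤ ((i / K + 1 : ℕ) : ℝ) * h := by exact_mod_cast h6
      rw [NNReal.coe_mul, NNReal.coe_natCast, abs_of_nonneg (by linarith)]
      push_cast
      linarith
    change ‖X (fun i => l i) i - G (fun i => l i) (i / K + 1)‖ ≤ _ at hgoal
    have h7 := norm_sub_le_norm_sub_add_norm_sub (M'.run l t) (X (fun i => l i) i)
      (G (fun i => l i) (i / K + 1))
    have h8 := norm_sub_le_norm_sub_add_norm_sub (M'.run l t) (G (fun i => l i) (i / K + 1))
      (M.run l t)
    rw [norm_sub_rev]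
    linarith
  · intro l i
    have h1 := hmove l i
    have hc : ∀ i : ℕ, M'.run l (i * σ) = X (fun i => l i) i := fun i => by
      rw [hrun, mul_div_cancel_right₀ _ hσ0.ne', chain_natCast]
    have hc' : M'.run l ((i + 1) * σ) = X (fun i => l i) (i + 1) := by exact_mod_cast hc (i + 1)
    rw [hc, hc', hnext]
    rcases h1 with h1 | h1 | h1
    · exact Or.inl h1
    · exact Or.inr (Or.inl h1)
    · exact Or.inr (Or.inr (P.isAvoidanceMove_of_isCcwMove h1))

/-! ### Recursion over the lions. -/

/-- A strategy against `n` lions together with its parameters. -/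
structure Stage (ε : ℝ) (m₀ : Plane) (l₀ : ℕ → Plane) (n : ℕ) where
  strategy : StrategyAgainst ε m₀ l₀ n
  gap : ℝ
  radius : ℝ
  step : ℝ≥0
  divisor : ℕ

namespace Stage

variable {ε : ℝ} {m₀ : Plane} {l₀ : ℕ → Plane} {n : ℕ}

/-- The strategy keeps a positive distance to lion `n` and runs along equal segments. -/
def IsGood (S : Stage ε m₀ l₀ n) : Prop :=
  0 < S.gap ∧ (∀ (l : ∀ i, LionPath (l₀ i)) (t : ℝ≥0), S.gap ≤ ‖S.strategy.run l t - l n t‖) ∧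
    S.strategy.IsEquitemporal S.step ∧
    ∀ l : ∀ i, LionPath (l₀ i), IsEqualPolygonal (S.strategy.run l) S.step (1 + excess ε n)

/-- The stage `S'` results from `S` by evading one more lion within distance `δ`. -/
def Refines (S' : Stage ε m₀ l₀ (n + 1)) (S : Stage ε m₀ l₀ n) (δ : ℝ) : Prop :=
  (∀ (l : ∀ i, LionPath (l₀ i)) (t : ℝ≥0), ‖S.strategy.run l t - S'.strategy.run l t‖ ≤ δ) ∧
    0 < S'.radius ∧ 0 < S'.divisor ∧ S.step * (1 + excess ε n) / S'.divisor ≤ δ / 2 ∧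
    ∀ l : ∀ i, LionPath (l₀ i), FollowsByMoves S'.radius S'.step (1 + excess ε (n + 1))
      (S.step / S'.divisor) (S.strategy.run l) (l (n + 1)) (S'.strategy.run l)

/-- The stage of a man who never moves. -/
def still (hε : 0 < ε) (m₀ : Plane) (l₀ : ℕ → Plane) (n : ℕ) : Stage ε m₀ l₀ n where
  strategy :=
    { toFun := fun _ => ⟨fun _ => m₀, rfl, fun s t => by simpa using by positivity⟩
      causal := fun _ _ _ _ _ _ => rfl }
  gap := 0
  radius := 0
  step := 0
  divisor := 0

theorem exists_isGood_one (hε : 0 < ε) (hl : l₀ 1 ≠ m₀) :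
    ∃ S : Stage ε m₀ l₀ 1, S.IsGood := by
  obtain ⟨M, c, h⟩ := exists_strategy_one hε m₀ l₀ hl
  exact ⟨⟨M, c, 0, 1, 0⟩, h⟩

theorem IsGood.exists_refines (hε : 0 < ε) (hl : l₀ (n + 1) ≠ m₀) {S : Stage ε m₀ l₀ n}
    (hS : S.IsGood) {δ : ℝ} (hδ : 0 < δ) :
    ∃ S' : Stage ε m₀ l₀ (n + 1), S'.IsGood ∧ S'.Refines S δ := by
  obtain ⟨M, c, r, σ, p, h1, h2, h3, h4, h5, h6⟩ := exists_strategy_succ hε hl hS.2.2.1 hS.2.2.2 hδ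
  exact ⟨⟨M, c, r, σ, p⟩, ⟨h1, h2, h4, h5⟩, h3, h6⟩

/-- A good refinement of a stage if there is one. -/
noncomputable def next (hε : 0 < ε) (S : Stage ε m₀ l₀ n) (δ : ℝ) : Stage ε m₀ l₀ (n + 1) :=
  open Classical in
  if h : ∃ S' : Stage ε m₀ l₀ (n + 1), S'.IsGood ∧ S'.Refines S δ then h.choose
  else still hε m₀ l₀ (n + 1)

/-- The successive stages for the tolerances `δ 2, δ 3, …`. -/
noncomputable def seq (hε : 0 < ε) (hl : l₀ 1 ≠ m₀) (δ : ℕ → ℝ) : ∀ n, Stage ε m₀ l₀ n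
  | 0 => still hε m₀ l₀ 0
  | 1 => (exists_isGood_one hε hl).choose
  | n + 2 => (seq hε hl δ (n + 1)).next hε (δ (n + 2))

theorem seq_spec (hε : 0 < ε) (hl : ∀ i, 1 ≤ i → l₀ i ≠ m₀) {δ : ℕ → ℝ}
    (hδ : ∀ i, 2 ≤ i → 0 < δ i) (n : ℕ) :
    (seq hε (hl 1 le_rfl) δ (n + 1)).IsGood ∧
      (seq hε (hl 1 le_rfl) δ (n + 2)).IsGood ∧
      (seq hε (hl 1 le_rfl) δ (n + 2)).Refines (seq hε (hl 1 le_rfl) δ (n + 1)) (δ (n + 2)) := by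
  have hstep : ∀ n, (seq hε (hl 1 le_rfl) δ (n + 1)).IsGood →
      (seq hε (hl 1 le_rfl) δ (n + 2)).IsGood ∧
      (seq hε (hl 1 le_rfl) δ (n + 2)).Refines
        (seq hε (hl 1 le_rfl) δ (n + 1)) (δ (n + 2)) := by
    intro n hn
    have h := hn.exists_refines hε (hl (n + 1 + 1) (by omega)) (hδ (n + 2) (by omega))
    rw [seq, next, dif_pos h]
    exact h.choose_spec
  induction n with
  | zero =>
    have h1 : (seq hε (hl 1 le_rfl) δ 1).IsGood := (exists_isGood_one hε (hl 1 le_rfl)).choose_spec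
    exact ⟨h1, hstep 0 h1⟩
  | succ n ih => exact ⟨ih.2.1, hstep (n + 1) ih.2.1⟩

/-- Each stage is chosen from the previous stage and a single tolerance, not from the whole
sequence, so later tolerances have no influence. -/
theorem seq_congr (hε : 0 < ε) (hl : l₀ 1 ≠ m₀) {δ δ' : ℕ → ℝ} (n : ℕ)
    (h : ∀ i, 2 ≤ i → i ≤ n + 1 → δ i = δ' i) : seq hε hl δ (n + 1) = seq hε hl δ' (n + 1) := by
  induction n with
  | zero => rfl
  | succ n ih => rw [seq, seq, ih fun i h1 h2 => h i h1 (by omega), h (n + 2) (by omega) le_rfl]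

end Stage


theorem lemma2 (ε : ℝ) (hε : 0 < ε) (m₀ : Plane) (l₀ : ℕ → Plane)
    (hl₀ : ∀ i, 1 ≤ i → l₀ i ≠ m₀) :
    ∃ (M : (ℕ → ℝ) → (n : ℕ) → StrategyAgainst ε m₀ l₀ n)
      (c r : (ℕ → ℝ) → ℕ → ℝ) (σ : (ℕ → ℝ) → ℕ → ℝ≥0) (p : (ℕ → ℝ) → ℕ → ℕ),
      (∀ δ : ℕ → ℝ, (∀ i, 2 ≤ i → 0 < δ i) → ∀ n, 1 ≤ n →
        0 < c δ n ∧
        (∀ (l : ∀ i, LionPath (l₀ i)) (t : ℝ≥0), c δ n ≤ ‖(M δ n).run l t - l n t‖) ∧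
        (2 ≤ n → ∀ (l : ∀ i, LionPath (l₀ i)) (t : ℝ≥0),
          ‖(M δ (n - 1)).run l t - (M δ n).run l t‖ ≤ δ n) ∧
        (M δ n).IsEquitemporal (σ δ n) ∧
        (∀ l : ∀ i, LionPath (l₀ i),
          IsEqualPolygonal ((M δ n).run l) (σ δ n) (1 + excess ε n)) ∧
        (2 ≤ n →
          0 < r δ n ∧ 0 < p δ n ∧
          σ δ (n - 1) * (1 + excess ε (n - 1)) / p δ n ≤ δ n / 2 ∧
          ∀ l : ∀ i, LionPath (l₀ i),
            FollowsByMoves (r δ n) (σ δ n) (1 + excess ε n) (σ δ (n - 1) / p δ n)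
              ((M δ (n - 1)).run l) (l n) ((M δ n).run l))) ∧
      (∀ δ δ' : ℕ → ℝ, (∀ i, 2 ≤ i → 0 < δ i) → (∀ i, 2 ≤ i → 0 < δ' i) →
        ∀ n, 1 ≤ n → (∀ i, 2 ≤ i → i ≤ n → δ i = δ' i) →
          M δ n = M δ' n ∧ c δ n = c δ' n ∧ r δ n = r δ' n ∧
            σ δ n = σ δ' n ∧ p δ n = p δ' n) := by
  refine ⟨fun δ n => (Stage.seq hε (hl₀ 1 le_rfl) δ n).strategy,
    fun δ n => (Stage.seq hε (hl₀ 1 le_rfl) δ n).gap,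
    fun δ n => (Stage.seq hε (hl₀ 1 le_rfl) δ n).radius,
    fun δ n => (Stage.seq hε (hl₀ 1 le_rfl) δ n).step,
    fun δ n => (Stage.seq hε (hl₀ 1 le_rfl) δ n).divisor, ?_, ?_⟩
  · intro δ hδ n hn
    obtain ⟨k, rfl⟩ : ∃ k, n = k + 1 := ⟨n - 1, by omega⟩
    obtain ⟨h1, h2, h3, h4⟩ := (Stage.seq_spec hε hl₀ hδ k).1
    refine ⟨h1, h2, fun h => ?_, h3, h4, fun h => ?_⟩ <;>
      obtain ⟨j, rfl⟩ : ∃ j, k = j + 1 := ⟨k - 1, by omega⟩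
    · exact (Stage.seq_spec hε hl₀ hδ j).2.2.1
    · exact (Stage.seq_spec hε hl₀ hδ j).2.2.2
  · intro δ δ' _ _ n hn h
    obtain ⟨k, rfl⟩ : ∃ k, n = k + 1 := ⟨n - 1, by omega⟩
    have := Stage.seq_congr hε (hl₀ 1 le_rfl) k h
    simp only [this, and_self]
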